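/- Let $p\ge 1$ and $n_1,\dots,n_p\ge 1$ be integers, $n=\sum_i n_i$, $N=\prod_i n_i$, and let $V=\mathbb R^{n_1}\otimes\cdots\otimes\mathbb R^{n_p}$, with coordinates $v_\alpha$, $\alpha\in\{1,\dots,n_1\}\times\cdots\times\{1,\dots,n_p\}$. Let $X\subset V$ be the manifold of non-zero rank-one tensors $x_1\otimes\cdots\otimes x_p$, $x_i\in\mathbb R^{n_i}$, and for $v\in V$ let $d_v(x)=\sum_\alpha (v_\alpha-x_\alpha)^2$. A point $x\in X$ is a critical point of $d_v$ on $X$ if the derivative of $d_v$ at $x$ vanishes on the tangent space $T_xX$. Suppose that $v\in V$ is drawn from the standard Gaussian distribution with density $$\omega(v)=\frac{1}{(2\pi)^{N/2}}e^{-(\sum_\alpha v_\alpha^2)/2}.$$ Then the number of critical points of $d_v$ on $X$ is an almost everywhere measurable function of $v$ with values in $\{0,1,2,\dots\}\cup\{\infty\}$, and its expected value is finite and equals $$\frac{(2\pi)^{p/2}}{2^{n/2}}\,\frac{1}{\prod_{i=1}^p\Gamma\left(\frac{n_i}{2}\right)}\int_{W_1}|\det C(w_1)|\,d\mu_{W_1}.$$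 Here $W_1$ is the space of dimension $1+\sum_{i<j}(n_i-1)(n_j-1)$ with coordinates $w_0\in\mathbb R$ and $C_{ij}\in\mathbb R^{(n_i-1)\times(n_j-1)}$ for $i<j$; $C(w_1)$ is the symmetric $(n-p)\times(n-p)$ matrix made of $p\times p$ blocks whose $i$-th diagonal block is $w_0I_{n_i-1}$ and whose $(i,j)$ and $(j,i)$ blocks for $i<j$ are $C_{ij}$ and $C_{ij}^T$; $\mu_{W_1}$ is the probability measure making $w_0$ and all the entries of the $C_{ij}$ independent standard normal variables (the determinant of the empty matrix is $1$), and the function $|\det C(w_1)|$ is integrable with respect to $\mu_{W_1}$. -/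

import Mathlib

open scoped ContDiff

noncomputable section

namespace RankOneApprox

/-- The space `V = ℝ^{n₁} ⊗ ⋯ ⊗ ℝ^{n_p}` of real `n₁ × ⋯ × n_p` tensors, in coordinates `v α`
where the multi-index `α` runs over `{1,…,n₁} × ⋯ × {1,…,n_p}`, with the Euclidean norm. -/
abbrev Tensor {p : ℕ} (n : Fin p → ℕ) : Type :=
  EuclideanSpace ℝ ((i : Fin p) → Fin (n i))

/-- The tensor `x₁ ⊗ ⋯ ⊗ x_p`, whose `α`-coordinate is `∏ᵢ (xᵢ)_{αᵢ}`. -/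
def pureTensor {p : ℕ} {n : Fin p → ℕ} (x : (i : Fin p) → EuclideanSpace ℝ (Fin (n i))) :
    Tensor n :=
  WithLp.toLp 2 (fun α => ∏ i, x i (α i))

/-- The manifold `X ⊆ V` of non-zero rank-one tensors. -/
def rankOne {p : ℕ} (n : Fin p → ℕ) : Set (Tensor n) :=
  {x | x ≠ 0 ∧ ∃ y : (i : Fin p) → EuclideanSpace ℝ (Fin (n i)), x = pureTensor y}

/-- The squared Euclidean distance `d_v(x) = ∑_α (v_α - x_α)²`. -/
def sqDist {p : ℕ} {n : Fin p → ℕ} (v x : Tensor n) : ℝ :=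
  ∑ α, (v α - x α) ^ 2

/-- `x` is a critical point of `f` on the submanifold `X` of a normed space: `x ∈ X` and the
derivative of `f` at `x` vanishes along the velocity of every smooth curve lying in `X` and
passing through `x`. -/
def IsCriticalPointOn {E : Type*} [NormedAddCommGroup E] [NormedSpace ℝ E]
    (f : E → ℝ) (X : Set E) (x : E) : Prop :=
  x ∈ X ∧ ∀ γ : ℝ → E, ContDiff ℝ ∞ γ → γ 0 = x → (∀ᶠ t in nhds (0 : ℝ), γ t ∈ X) →
    HasDerivAt (fun t => f (γ t)) 0 0

/-- The number (possibly `∞`) of critical points of `d_v` on the manifold of non-zero rank-one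
tensors. -/
def critCount {p : ℕ} {n : Fin p → ℕ} (v : Tensor n) : ENNReal :=
  (({x : Tensor n | IsCriticalPointOn (sqDist v) (rankOne n) x}.encard : ℕ∞) : ENNReal)

/-- The standard Gaussian distribution on `V`: the measure with density
`ω(v) = (2π)^{-N/2} exp(-(∑_α v_α²)/2)`, `N = ∏ᵢ nᵢ`, with respect to Lebesgue measure. -/
def tensorGaussian {p : ℕ} (n : Fin p → ℕ) : MeasureTheory.Measure (Tensor n) :=
  MeasureTheory.volume.withDensity (fun v =>
    ENNReal.ofReal (1 / (2 * Real.pi) ^ (((∏ i, n i : ℕ) : ℝ) / 2) *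
      Real.exp (-(∑ α, v α ^ 2) / 2)))

/-- Row and column indices of `C(w₁)`: a block `i` and a position in `{1,…,nᵢ-1}`. -/
abbrev BlockIdx {p : ℕ} (n : Fin p → ℕ) : Type := (i : Fin p) × Fin (n i - 1)

/-- Index set of the entries of the matrices `C_{ij}`, `i < j`: a row index in block `i` together
with a column index in block `j`. -/
abbrev OffDiagIdx {p : ℕ} (n : Fin p → ℕ) : Type :=
  {q : BlockIdx n × BlockIdx n // q.1.1 < q.2.1}

/-- The space `W₁`, with coordinates `w₀` and the entries of the `C_{ij}`, `i < j`. -/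
abbrev W1 {p : ℕ} (n : Fin p → ℕ) : Type := ℝ × (OffDiagIdx n → ℝ)

/-- The measure on `W₁` under which all coordinates are independent standard Gaussians. -/
def gaussianW1 {p : ℕ} (n : Fin p → ℕ) : MeasureTheory.Measure (W1 n) :=
  (ProbabilityTheory.gaussianReal 0 1).prod
    (MeasureTheory.Measure.pi (fun _ : OffDiagIdx n => ProbabilityTheory.gaussianReal 0 1))

/-- The symmetric block matrix `C(w₁)` with `C_{ij}` as its `(i,j)` block and `C_{ij}ᵀ` as its
`(j,i)` block for `i < j`, and `w₀ I` as its diagonal blocks. -/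
def blockMatrix {p : ℕ} {n : Fin p → ℕ} (w : W1 n) : Matrix (BlockIdx n) (BlockIdx n) ℝ :=
  Matrix.of fun a b =>
    if h : a.1 < b.1 then w.2 ⟨(a, b), h⟩
    else if h : b.1 < a.1 then w.2 ⟨(b, a), h⟩
    else if a = b then w.1 else 0

end RankOneApprox

end

/-!
Critical rank-one approximations are counted through the end point map of the normal bundle of the
manifold `X` of rank-one tensors: `x` is a critical point of `d_v` exactly when `v = x + u` with `u`
normal to `X` at `x`. The expected number of critical points is therefore the integral of the
Jacobian of this map against the Gaussian density of its end point, by the area formula with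
multiplicities (`area_formula`).

For the computation write `nᵢ = mᵢ + 1`. Up to a null set of `v`, all critical points have a
non-zero `0`-coordinate (`ae_critical_zero_ne`), so that `x` is a multiple of
`(1, y₁) ⊗ ⋯ ⊗ (1, y_p)`. A rotation `rot yᵢ` taking `e₀` to the direction of `(1, yᵢ)` carries the
normal space at `e₀ ⊗ ⋯ ⊗ e₀`, which is spanned by the basis tensors whose multi-indices have at
least two non-zero entries, to the normal space at `x`. The multi-indices with exactly one non-zero
entry are left over for the coordinates of the `yᵢ`, and so the end point map becomes a map `param`
from `V` to itself, whose fibers are the sets of critical points (`bijOn_footpoint`).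

In the rotated frame, the derivative of `param` is the identity in the directions of the line and of
the normal space. On the remaining block it is the product of `w₀ I - C` and of the Jacobians of the
central projections to the spheres, since the infinitesimal rotations are skew-symmetric
(`framedJac_unitIdx`). Hence the Jacobian is `|det (w₀ I - C)| ∏ |(1, yᵢ)|^(-nᵢ)`, where `w₀` and `C`
are made of coordinates on the line and on the normal space (`abs_det_fderiv_param`). As the
rotations are orthogonal, the Gaussian density depends only on these coordinates too. The integral
splits into the expectation of `|det C(w₁)|` and the volumes `π^(nᵢ/2) / Γ(nᵢ/2)` of the projective
spaces (`lintegral_hyp_pow`).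
-/

/-! ### The area formula with multiplicities -/

namespace RankOneApprox

open MeasureTheory Set

/-- The number of points of `s` which `f` maps to `v`, possibly infinite. -/
noncomputable def fiberCount {E F : Type*} (f : E → F) (s : Set E) (v : F) : ENNReal :=
  (({x | x ∈ s ∧ f x = v}.encard : ℕ∞) : ENNReal)

theorem fiberCount_iUnion {E F : Type*} (f : E → F) {t : ℕ → Set E}
    (hd : Pairwise (Function.onFun Disjoint t)) (hinj : ∀ k, InjOn f (t k)) (v : F) :
    fiberCount f (⋃ k, t k) v = ∑' k, (f '' t k).indicator 1 v := by
  let _ : MeasurableSpace E := ⊤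
  have hpiece : ∀ k, Measure.count {x | x ∈ t k ∧ f x = v} = (f '' t k).indicator 1 v := by
    intro k
    by_cases hv : v ∈ f '' t k
    · obtain ⟨x, hx, rfl⟩ := hv
      have : {y | y ∈ t k ∧ f y = f x} = {x} := by
        ext y
        exact ⟨fun h => hinj k h.1 hx h.2, fun h => by rw [mem_singleton_iff.1 h]; exact ⟨hx, rfl⟩⟩
      rw [this, indicator_of_mem (mem_image_of_mem f hx)]
      simp
    · have : {y | y ∈ t k ∧ f y = v} = ∅ := by
        ext y
        simp only [mem_ofPred_eq, mem_empty_iff_false, iff_false]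
        exact fun h => hv ⟨y, h.1, h.2⟩
      rw [this, indicator_of_notMem hv]
      simp
  have hset : {x | x ∈ ⋃ k, t k ∧ f x = v} = ⋃ k, {x | x ∈ t k ∧ f x = v} := by
    ext x
    simp
  rw [fiberCount, ← Measure.count_apply, hset, measure_iUnion]
  · exact tsum_congr hpiece
  · intro a b hab
    exact (hd hab).mono (fun x hx => hx.1) (fun x hx => hx.1)
  · exact fun _ => trivial
  · trivial

section AreaFormula

variable {E : Type*} [NormedAddCommGroup E] [NormedSpace ℝ E] [FiniteDimensional ℝ E]
  [MeasurableSpace E] [BorelSpace E] (μ : Measure E) [μ.IsAddHaarMeasure]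

/-- A differentiable map with non-vanishing Jacobian on `s` is injective on each of countably many
measurable pieces of `s`, by approximating it by linear isomorphisms. -/
theorem exists_injective_partition {f : E → E} {s : Set E}
    (hs : MeasurableSet s) {f' : E → E →L[ℝ] E} (hf' : ∀ x ∈ s, HasFDerivWithinAt f (f' x) s x)
    (hdet : ∀ x ∈ s, (f' x).det ≠ 0) :
    ∃ t : ℕ → Set E, Pairwise (Function.onFun Disjoint t) ∧ (∀ k, MeasurableSet (t k)) ∧
      (∀ k, InjOn f (t k)) ∧ s = ⋃ k, t k := by
  classical
  have hr : ∀ A : E →L[ℝ] E, ∃ r : NNReal, r ≠ 0 ∧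
      (A.det ≠ 0 → ∀ u : Set E, ApproximatesLinearOn f A u r → InjOn f u) := by
    intro A
    by_cases hA : A.det = 0
    · exact ⟨1, one_ne_zero, fun h => absurd hA h⟩
    · set B := A.toContinuousLinearEquivOfDetNeZero hA with hB
      have hBA : (B : E →L[ℝ] E) = A := by
        ext x
        simp [hB]
      rcases subsingleton_or_nontrivial E with hE | hE
      · exact ⟨1, one_ne_zero, fun _ u _ x _ y _ _ => Subsingleton.elim x y⟩
      · have hpos : 0 < ‖(B.symm : E →L[ℝ] E)‖₊ := B.nnnorm_symm_pos
        refine ⟨‖(B.symm : E →L[ℝ] E)‖₊⁻¹ / 2, by positivity, fun _ u hu => ?_⟩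
        rw [← hBA] at hu
        exact hu.injOn (Or.inr (NNReal.half_lt_self (by positivity)))
  choose r hr0 hr using hr
  obtain ⟨t, A, hd, hm, hcov, happ, hA⟩ :=
    exists_partition_approximatesLinearOn_of_hasFDerivWithinAt f s f' hf' r hr0
  refine ⟨fun k => s ∩ t k, fun a b hab => (hd hab).mono inter_subset_right inter_subset_right,
    fun k => hs.inter (hm k), fun k => ?_, ?_⟩
  · rcases s.eq_empty_or_nonempty with rfl | hne
    · simp
    · obtain ⟨y, hy, hAy⟩ := hA hne k
      exact hr (A k) (hAy ▸ hdet y hy) _ (happ k)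
  · rw [← inter_iUnion, inter_eq_left.2 hcov]

/-- The area formula, counting multiplicities: the number of preimages is almost everywhere
measurable, and its weighted integral is the integral of the Jacobian. The points where the
Jacobian vanishes do not contribute, by Sard's theorem; the others form a countable union of
measurable sets on which `f` is injective. -/
theorem area_formula {f : E → E} {s : Set E} (hs : MeasurableSet s) {f' : E → E →L[ℝ] E}
    (hf' : ∀ x ∈ s, HasFDerivWithinAt f (f' x) s x)
    (hdet : MeasurableSet {x | x ∈ s ∧ (f' x).det = 0}) {g : E → ENNReal} (hg : Measurable g) :
    AEMeasurable (fiberCount f s) μ ∧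
      ∫⁻ v, fiberCount f s v * g v ∂μ =
        ∫⁻ x in s, ENNReal.ofReal |(f' x).det| * g (f x) ∂μ := by
  set s₀ := {x | x ∈ s ∧ (f' x).det = 0} with hs₀
  set s₁ := s \ s₀ with hs₁
  have hs₁m : MeasurableSet s₁ := hs.diff hdet
  have hf₁ : ∀ x ∈ s₁, HasFDerivWithinAt f (f' x) s₁ x := fun x hx => (hf' x hx.1).mono sdiff_subset
  obtain ⟨t, hd, hm, hinj, hU⟩ := exists_injective_partition hs₁m hf₁
    (fun x hx h => hx.2 ⟨hx.1, h⟩)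
  have hts : ∀ k, t k ⊆ s₁ := fun k => hU ▸ subset_iUnion t k
  have hft : ∀ k, ∀ x ∈ t k, HasFDerivWithinAt f (f' x) (t k) x :=
    fun k x hx => (hf₁ x (hts k hx)).mono (hts k)
  have him : ∀ k, MeasurableSet (f '' t k) := fun k =>
    measurable_image_of_fderivWithin (hm k) (hft k) (hinj k)
  have hnull : μ (f '' s₀) = 0 := addHaar_image_eq_zero_of_det_fderivWithin_eq_zero μ
    (fun x hx => (hf' x hx.1).mono fun y hy => hy.1) (fun x hx => hx.2)
  have hae : fiberCount f s =ᵐ[μ] fun v => ∑' k, (f '' t k).indicator 1 v := by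
    filter_upwards [compl_mem_ae_iff.2 hnull] with v hv
    rw [← fiberCount_iUnion f hd hinj, ← hU, fiberCount, fiberCount]
    congr 3
    ext x
    exact ⟨fun h => ⟨⟨h.1, fun h0 => hv ⟨x, h0, h.2⟩⟩, h.2⟩, fun h => ⟨h.1.1, h.2⟩⟩
  have hmeas : ∀ k, Measurable ((f '' t k).indicator (1 : E → ENNReal)) := fun k =>
    measurable_one.indicator (him k)
  refine ⟨⟨_, Measurable.tsum hmeas, hae⟩, ?_⟩
  have hzero : ∫⁻ x in s₀, ENNReal.ofReal |(f' x).det| * g (f x) ∂μ = 0 := by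
    rw [setLIntegral_congr_fun hdet (g := fun _ => 0) (fun x hx => by simp [hx.2])]
    simp
  have hsplit : s = s₀ ∪ s₁ := by
    rw [hs₁, union_sdiff_cancel]
    exact fun x hx => hx.1
  calc ∫⁻ v, fiberCount f s v * g v ∂μ
      = ∫⁻ v, ∑' k, (f '' t k).indicator g v ∂μ := by
        refine lintegral_congr_ae (hae.mono fun v hv => ?_)
        simp only [hv]
        rw [← ENNReal.tsum_mul_right]
        refine tsum_congr fun k => ?_
        by_cases h : v ∈ f '' t k
        · rw [indicator_of_mem h, indicator_of_mem h]; simp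
        · rw [indicator_of_notMem h, indicator_of_notMem h]; simp
    _ = ∑' k, ∫⁻ v in f '' t k, g v ∂μ := by
        rw [lintegral_tsum fun k => (hg.indicator (him k)).aemeasurable]
        exact tsum_congr fun k => lintegral_indicator (him k) g
    _ = ∑' k, ∫⁻ x in t k, ENNReal.ofReal |(f' x).det| * g (f x) ∂μ := tsum_congr fun k =>
        lintegral_image_eq_lintegral_abs_det_fderiv_mul μ (hm k) (hft k) (hinj k) g
    _ = ∫⁻ x in s₁, ENNReal.ofReal |(f' x).det| * g (f x) ∂μ := by
        rw [hU, lintegral_iUnion hm hd]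
    _ = ∫⁻ x in s, ENNReal.ofReal |(f' x).det| * g (f x) ∂μ := by
        conv_rhs => rw [hsplit]
        rw [lintegral_union hs₁m disjoint_sdiff_right, hzero, zero_add]

end AreaFormula

end RankOneApprox

/-! ### Rotations adapted to an affine chart of the sphere -/

namespace RankOneApprox

section Rotation

variable {m : ℕ}

/-- The length of the vector `(1, y)`. -/
noncomputable def hyp (y : Fin m → ℝ) : ℝ := √(1 + ∑ a, y a ^ 2)

/-- The unit vector `(1, y) / |(1, y)|`, i.e. the central projection of the point `y` of the affine
chart to the sphere. -/
noncomputable def unitVec (y : Fin m → ℝ) : Fin (m + 1) → ℝ :=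
  Fin.cons (1 / hyp y) (fun a => y a / hyp y)

/-- An orthogonal matrix with first column `unitVec y`, depending smoothly on `y`: the rotation by
`π` about the bisector `u + e₀` of `u = unitVec y` and `e₀`. -/
noncomputable def rot (y : Fin m → ℝ) : Matrix (Fin (m + 1)) (Fin (m + 1)) ℝ :=
  Matrix.of fun a b => (unitVec y a + Pi.single (M := fun _ => ℝ) 0 1 a) *
    (unitVec y b + Pi.single (M := fun _ => ℝ) 0 1 b) / (1 + unitVec y 0) -
      (1 : Matrix (Fin (m + 1)) (Fin (m + 1)) ℝ) a b

theorem hyp_sq (y : Fin m → ℝ) : hyp y ^ 2 = 1 + ∑ a, y a ^ 2 :=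
  Real.sq_sqrt (by positivity)

theorem hyp_pos (y : Fin m → ℝ) : 0 < hyp y :=
  Real.sqrt_pos.2 (by positivity)

@[simp] theorem unitVec_zero (y : Fin m → ℝ) : unitVec y 0 = 1 / hyp y := rfl

@[simp] theorem unitVec_succ (y : Fin m → ℝ) (a : Fin m) : unitVec y a.succ = y a / hyp y := rfl

theorem unitVec_zero_pos (y : Fin m → ℝ) : 0 < unitVec y 0 := by
  rw [unitVec_zero]
  exact one_div_pos.2 (hyp_pos y)

theorem sum_unitVec_sq (y : Fin m → ℝ) : ∑ a, unitVec y a * unitVec y a = 1 := by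
  have h := hyp_pos y
  rw [Fin.sum_univ_succ]
  simp only [unitVec_zero, unitVec_succ]
  have : ∀ a, y a / hyp y * (y a / hyp y) = y a ^ 2 / hyp y ^ 2 := fun a => by ring
  simp only [this]
  rw [← Finset.sum_div, show ∑ a, y a ^ 2 = hyp y ^ 2 - 1 by rw [hyp_sq]; ring]
  field_simp
  ring

theorem rot_transpose (y : Fin m → ℝ) : (rot y).transpose = rot y := by
  ext a b
  simp only [Matrix.transpose_apply, rot, Matrix.of_apply]
  rw [← Matrix.transpose_apply (1 : Matrix (Fin (m + 1)) (Fin (m + 1)) ℝ) a b,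
    Matrix.transpose_one]
  ring

theorem rot_comm (y : Fin m → ℝ) (a b : Fin (m + 1)) : rot y a b = rot y b a :=
  congrFun (congrFun (rot_transpose y) b) a

theorem rot_apply_zero (y : Fin m → ℝ) (a : Fin (m + 1)) : rot y a 0 = unitVec y a := by
  have h := unitVec_zero_pos y
  have h' : 1 + unitVec y 0 ≠ 0 := by positivity
  simp only [rot, Matrix.of_apply, Pi.single_eq_same]
  rw [mul_div_assoc, add_comm (unitVec y 0) 1, div_self h', mul_one, Matrix.one_apply,
    Pi.single_apply]
  ring

theorem rot_mul_self (y : Fin m → ℝ) : rot y * rot y = 1 := by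
  set g : Fin (m + 1) → ℝ := fun a => unitVec y a + Pi.single (M := fun _ => ℝ) 0 1 a with hg
  set k := 1 + unitVec y 0 with hk
  have h := unitVec_zero_pos y
  have hk0 : k ≠ 0 := by positivity
  have hR : rot y = k⁻¹ • Matrix.vecMulVec g g - 1 := by
    ext a b
    simp only [rot, Matrix.of_apply, Matrix.sub_apply, Matrix.smul_apply, Matrix.vecMulVec_apply,
      smul_eq_mul, g, k]
    ring
  have hgg : g ⬝ᵥ g = 2 * k := by
    simp only [dotProduct, g, add_mul, mul_add, Finset.sum_add_distrib, sum_unitVec_sq]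
    simp [Pi.single_apply, k]
    ring
  rw [hR, sub_mul, mul_sub, mul_sub, Matrix.smul_mul, Matrix.mul_smul,
    Matrix.vecMulVec_mul_vecMulVec, hgg]
  simp only [Matrix.vecMulVec_smul, Matrix.mul_one, Matrix.one_mul, smul_smul]
  rw [show k⁻¹ * (k⁻¹ * (2 * k)) = k⁻¹ + k⁻¹ by field_simp; ring, add_smul]
  abel

theorem rot_sum_mul (y : Fin m → ℝ) (a b : Fin (m + 1)) :
    ∑ c, rot y c a * rot y c b = (1 : Matrix (Fin (m + 1)) (Fin (m + 1)) ℝ) a b := by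
  rw [← rot_mul_self y, Matrix.mul_apply]
  exact Finset.sum_congr rfl fun c _ => by rw [rot_comm y c a]

theorem contDiff_hyp : ContDiff ℝ 1 (hyp : (Fin m → ℝ) → ℝ) := by
  unfold hyp
  exact ContDiff.sqrt (by fun_prop) fun y => by positivity

theorem contDiff_unitVec (a : Fin (m + 1)) :
    ContDiff ℝ 1 (fun y : Fin m → ℝ => unitVec y a) := by
  refine Fin.cases ?_ (fun a => ?_) a
  · exact contDiff_const.div contDiff_hyp fun y => (hyp_pos y).ne'
  · exact ContDiff.div (by fun_prop) contDiff_hyp fun y => (hyp_pos y).ne'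

theorem contDiff_rot (a b : Fin (m + 1)) : ContDiff ℝ 1 (fun y : Fin m → ℝ => rot y a b) := by
  simp only [rot, Matrix.of_apply]
  refine ContDiff.sub (ContDiff.div ?_ ?_ fun y => ?_) contDiff_const
  · exact ((contDiff_unitVec a).add contDiff_const).mul ((contDiff_unitVec b).add contDiff_const)
  · exact contDiff_const.add (contDiff_unitVec 0)
  · have := unitVec_zero_pos y
    positivity

/-- The velocity of `unitVec` in the chart direction `b`. -/
theorem hasDerivAt_unitVec (y : Fin m → ℝ) (b : Fin m) (c : Fin (m + 1)) :
    HasDerivAt (fun t : ℝ => unitVec (y + t • Pi.single b 1) c)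
      (((1 : Matrix (Fin (m + 1)) (Fin (m + 1)) ℝ) c b.succ -
        unitVec y c * unitVec y b.succ) / hyp y) 0 := by
  have hpos := hyp_pos y
  have hcoord : ∀ a, HasDerivAt (fun t : ℝ => (y + t • Pi.single (M := fun _ => ℝ) b 1) a)
      (Pi.single (M := fun _ => ℝ) b 1 a) 0 := by
    intro a
    simpa using ((hasDerivAt_id (0 : ℝ)).mul_const (Pi.single (M := fun _ => ℝ) b 1 a)).const_add
      (y a)
  have hh : HasDerivAt (fun t : ℝ => hyp (y + t • Pi.single b 1)) (y b / hyp y) 0 := by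
    have h1 : HasDerivAt (fun t : ℝ => 1 + ∑ a, (y + t • Pi.single (M := fun _ => ℝ) b 1) a ^ 2)
        (2 * y b) 0 := by
      have := (HasDerivAt.fun_sum (u := Finset.univ) fun a _ => (hcoord a).pow 2).const_add 1
      refine this.congr_deriv ?_
      simp [Pi.single_apply]
    have h2 := h1.sqrt (by simp only [zero_smul, add_zero]; positivity)
    refine h2.congr_deriv ?_
    simp only [zero_smul, add_zero]
    change 2 * y b / (2 * hyp y) = _
    field_simp
  have hne : hyp (y + (0 : ℝ) • Pi.single b 1) ≠ 0 := (hyp_pos _).ne'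
  refine Fin.cases ?_ (fun a => ?_) c
  · refine ((hasDerivAt_const (0 : ℝ) (1 : ℝ)).div hh hne).congr_deriv ?_
    simp only [zero_smul, add_zero, unitVec_zero, unitVec_succ]
    rw [Matrix.one_apply_ne (Fin.succ_ne_zero b).symm]
    field_simp
  · refine ((hcoord a).div hh hne).congr_deriv ?_
    simp only [zero_smul, add_zero, unitVec_succ, Matrix.one_apply, Pi.single_apply,
      Fin.succ_inj]
    field_simp

/-- The Jacobian of `unitVec` at `y`, expressed in the orthonormal frame of the tangent space of the
sphere which consists of the columns of `rot y` other than the first one. -/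
noncomputable def frameJac (y : Fin m → ℝ) : Matrix (Fin m) (Fin m) ℝ :=
  Matrix.of fun a b => rot y a.succ b.succ / hyp y

theorem hasDerivAt_frame_unitVec (y : Fin m → ℝ) (a b : Fin m) :
    HasDerivAt (fun t : ℝ => ∑ c, rot y c a.succ * unitVec (y + t • Pi.single b 1) c)
      (frameJac y a b) 0 := by
  refine (HasDerivAt.fun_sum (u := Finset.univ) fun c _ =>
    (hasDerivAt_unitVec y b c).const_mul (rot y c a.succ)).congr_deriv ?_
  have h1 : ∑ c, rot y c a.succ * (1 : Matrix (Fin (m + 1)) (Fin (m + 1)) ℝ) c b.succ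
      = rot y b.succ a.succ := by
    simp [Matrix.one_apply]
  have h2 : ∑ c, rot y c a.succ * unitVec y c = 0 := by
    simp only [← rot_apply_zero]
    rw [rot_sum_mul, Matrix.one_apply_ne (Fin.succ_ne_zero a)]
  calc _ = (∑ c, rot y c a.succ * (1 : Matrix (Fin (m + 1)) (Fin (m + 1)) ℝ) c b.succ
          - (∑ c, rot y c a.succ * unitVec y c) * unitVec y b.succ) / hyp y := by
        rw [Finset.sum_mul, ← Finset.sum_sub_distrib, Finset.sum_div]
        exact Finset.sum_congr rfl fun c _ => by ring
    _ = _ := by rw [h1, h2, rot_comm, frameJac, Matrix.of_apply]; ring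

/-- The infinitesimal rotation of the frame `rot` in the chart direction `b` is skew-symmetric, so
that its first row is minus its first column, and this column is given by `frameJac`. -/
theorem exists_hasDerivAt_frame_rot (y : Fin m → ℝ) (b : Fin m) :
    ∃ A : Matrix (Fin (m + 1)) (Fin (m + 1)) ℝ,
      (∀ a c, HasDerivAt (fun t : ℝ => ((rot y).transpose * rot (y + t • Pi.single b 1) :
        Matrix (Fin (m + 1)) (Fin (m + 1)) ℝ) a c)
        (A a c) 0) ∧
      (∀ a, A a.succ 0 = frameJac y a b) ∧ ∀ a, A 0 a.succ = -frameJac y a b := by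
  set G : ℝ → Matrix (Fin (m + 1)) (Fin (m + 1)) ℝ :=
    fun t => (rot y).transpose * rot (y + t • Pi.single b 1) with hG
  have hdiff : ∀ a c, DifferentiableAt ℝ (fun t => G t a c) 0 := by
    intro a c
    simp only [hG, Matrix.mul_apply]
    refine DifferentiableAt.fun_sum fun d _ => DifferentiableAt.const_mul ?_ _
    have h1 : Differentiable ℝ (fun z : Fin m → ℝ => rot z d c) :=
      (contDiff_rot d c).differentiable one_ne_zero
    exact (h1 _).comp (0 : ℝ) (by fun_prop)
  have hG0 : G 0 = 1 := by
    simp only [hG, zero_smul, add_zero, rot_transpose, rot_mul_self]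
  have hGG : ∀ t, (G t).transpose * G t = 1 := by
    intro t
    simp only [hG, Matrix.transpose_mul, rot_transpose]
    rw [Matrix.mul_assoc, ← Matrix.mul_assoc (rot y), rot_mul_self, Matrix.one_mul, rot_mul_self]
  have hd := fun a c => (hdiff a c).hasDerivAt
  have hcol : ∀ a : Fin m, deriv (fun t => G t a.succ 0) 0 = frameJac y a b := by
    intro a
    refine (hd a.succ 0).unique ((hasDerivAt_frame_unitVec y a b).congr_of_eventuallyEq ?_)
    refine Filter.Eventually.of_forall fun t => ?_
    simp only [hG, Matrix.mul_apply, Matrix.transpose_apply, rot_apply_zero]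
  refine ⟨Matrix.of fun a c => deriv (fun t => G t a c) 0, hd, hcol, fun a => ?_⟩
  rw [Matrix.of_apply, ← hcol a]
  have h1 : HasDerivAt (fun t => ∑ d, G t d 0 * G t d a.succ)
      (deriv (fun t => G t a.succ 0) 0 + deriv (fun t => G t 0 a.succ) 0) 0 := by
    refine (HasDerivAt.fun_sum (u := Finset.univ) fun d _ =>
      (hd d 0).mul (hd d a.succ)).congr_deriv ?_
    simp [hG0, Matrix.one_apply, Finset.sum_add_distrib]
  have h2 : (fun t => ∑ d, G t d 0 * G t d a.succ) = fun _ => 0 := by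
    ext t
    have := congrFun (congrFun (hGG t) 0) a.succ
    rwa [Matrix.mul_apply, Matrix.one_apply_ne (Fin.succ_ne_zero a).symm] at this
  rw [h2] at h1
  linarith [h1.unique (hasDerivAt_const 0 (0 : ℝ))]

/-- Up to the factor `-1 / hyp y`, the matrix is a perturbation of the identity of rank one. -/
theorem abs_det_frameJac (y : Fin m → ℝ) : |(frameJac y).det| = (hyp y)⁻¹ ^ (m + 1) := by
  have hpos := hyp_pos y
  set k := ((hyp y) * (hyp y + 1))⁻¹ with hk
  have hM : frameJac y = (-(hyp y)⁻¹) • (1 + Matrix.replicateCol Unit (-k • y) *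
      Matrix.replicateRow Unit y) := by
    ext a b
    simp only [frameJac, rot, Matrix.of_apply, unitVec_succ, unitVec_zero, Matrix.smul_apply,
      Matrix.add_apply, Matrix.mul_apply, Matrix.replicateCol_apply, Matrix.replicateRow_apply,
      Finset.univ_unique, Finset.sum_singleton, Pi.smul_apply, smul_eq_mul, Matrix.one_apply, Fin.succ_inj,
      Pi.single_eq_of_ne (Fin.succ_ne_zero _), hk]
    field_simp
    ring
  have hyy : y ⬝ᵥ y = hyp y ^ 2 - 1 := by
    rw [hyp_sq, dotProduct]
    simp [sq]
  rw [hM, Matrix.det_smul, Matrix.det_one_add_replicateCol_mul_replicateRow, dotProduct_smul, hyy,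
    Fintype.card_fin, abs_mul, abs_pow, abs_neg, abs_of_pos (inv_pos.2 hpos), pow_succ _ m]
  congr 1
  rw [smul_eq_mul, show 1 + -k * (hyp y ^ 2 - 1) = (hyp y)⁻¹ by rw [hk]; field_simp; ring,
    abs_of_pos (inv_pos.2 hpos)]

end Rotation

end RankOneApprox

/-! ### Tensor products of matrices and the end point map -/

namespace RankOneApprox

section Kronecker

variable {ι : Type*} [Fintype ι] {κ : ι → Type*}

/-- The matrix of the tensor product of the endomorphisms with matrices `R i`. -/
def kron (R : ∀ i, Matrix (κ i) (κ i) ℝ) : Matrix (∀ i, κ i) (∀ i, κ i) ℝ :=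
  Matrix.of fun α β => ∏ i, R i (α i) (β i)

theorem kron_mul [DecidableEq ι] [∀ i, Fintype (κ i)] (R S : ∀ i, Matrix (κ i) (κ i) ℝ) :
    kron R * kron S = kron fun i => R i * S i := by
  ext α β
  simp only [kron, Matrix.mul_apply, Matrix.of_apply]
  rw [Finset.prod_univ_sum, Fintype.piFinset_univ]
  exact Finset.sum_congr rfl fun γ _ => Finset.prod_mul_distrib.symm

theorem kron_one [∀ i, DecidableEq (κ i)] : kron (fun i => (1 : Matrix (κ i) (κ i) ℝ)) = 1 := by
  ext α β
  simp only [kron, Matrix.of_apply]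
  by_cases h : α = β
  · subst h
    simp
  · rw [Matrix.one_apply_ne h]
    obtain ⟨i, hi⟩ := Function.ne_iff.1 h
    exact Finset.prod_eq_zero (Finset.mem_univ i) (Matrix.one_apply_ne hi)

theorem kron_transpose (R : ∀ i, Matrix (κ i) (κ i) ℝ) :
    (kron R).transpose = kron fun i => (R i).transpose := rfl

/-- An endomorphism of the `j`-th factor changes only the `j`-th index. -/
theorem kron_update_one_mulVec [DecidableEq ι] [∀ i, Fintype (κ i)] [∀ i, DecidableEq (κ i)] (j : ι) (G : Matrix (κ j) (κ j) ℝ) (v : (∀ i, κ i) → ℝ)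
    (α : ∀ i, κ i) :
    (kron (Function.update (fun i => (1 : Matrix (κ i) (κ i) ℝ)) j G)).mulVec v α =
      ∑ c, G (α j) c * v (Function.update α j c) := by
  have hk : ∀ β, kron (Function.update (fun i => (1 : Matrix (κ i) (κ i) ℝ)) j G) α β =
      G (α j) (β j) * ∏ i ∈ Finset.univ.erase j, (1 : Matrix (κ i) (κ i) ℝ) (α i) (β i) := by
    intro β
    rw [kron, Matrix.of_apply, ← Finset.mul_prod_erase _ _ (Finset.mem_univ j),
      Function.update_self]
    congr 1
    exact Finset.prod_congr rfl fun i hi => by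
      rw [Function.update_of_ne (Finset.ne_of_mem_erase hi)]
  rw [Matrix.mulVec, dotProduct, ← Finset.sum_fiberwise (s := Finset.univ) (g := fun β => β j)]
  refine Finset.sum_congr rfl fun c _ => ?_
  rw [Finset.sum_eq_single (Function.update α j c)]
  · rw [hk, Function.update_self]
    congr 1
    rw [Finset.prod_eq_one, mul_one]
    intro i hi
    rw [Function.update_of_ne (Finset.ne_of_mem_erase hi), Matrix.one_apply_eq]
  · intro β hβ hne
    have hβj : β j = c := (Finset.mem_filter.1 hβ).2
    obtain ⟨i, hi⟩ := Function.ne_iff.1 hne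
    have hij : i ≠ j := by
      rintro rfl
      rw [Function.update_self] at hi
      exact hi hβj
    rw [Function.update_of_ne hij] at hi
    have hz : ∏ i ∈ Finset.univ.erase j, (1 : Matrix (κ i) (κ i) ℝ) (α i) (β i) = 0 :=
      Finset.prod_eq_zero (Finset.mem_erase.2 ⟨hij, Finset.mem_univ i⟩)
        (Matrix.one_apply_ne (Ne.symm hi))
    rw [hk, hz, mul_zero, zero_mul]
  · intro h
    simp at h

theorem det_blockDiagonal' [LinearOrder ι] [∀ i, Fintype (κ i)] [∀ i, DecidableEq (κ i)]
    (M : ∀ i, Matrix (κ i) (κ i) ℝ) : (Matrix.blockDiagonal' M).det = ∏ i, (M i).det := by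
  rw [(Matrix.blockTriangular_blockDiagonal' M).det_fintype]
  refine Finset.prod_congr rfl fun i _ => ?_
  let e : κ i ≃ {a : (i : ι) × κ i // a.1 = i} :=
    { toFun := fun a => ⟨⟨i, a⟩, rfl⟩
      invFun := fun a => a.2 ▸ a.1.2
      left_inv := fun _ => rfl
      right_inv := by rintro ⟨⟨j, a⟩, rfl⟩; rfl }
  refine (Matrix.det_submatrix_equiv_self e _).symm.trans ?_
  congr 1
  ext a b
  exact Matrix.blockDiagonal'_apply_eq M i a b

/-- If the columns of a matrix outside of a set of indices are those of the identity matrix, then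
only the minor on this set contributes to the determinant. -/
theorem det_eq_det_submatrix {σ τ : Type*} [Fintype σ] [DecidableEq σ] [Fintype τ]
    [DecidableEq τ] (M : Matrix τ τ ℝ) (P : τ → Prop) (e : σ ≃ {α // P α})
    (hM : ∀ α β, ¬P β → M α β = (1 : Matrix τ τ ℝ) α β) :
    M.det = (M.submatrix (fun a => (e a : τ)) fun a => (e a : τ)).det := by
  classical
  have hone : (M.toSquareBlockProp fun α => ¬P α) = 1 := by
    ext α β
    rw [Matrix.toSquareBlockProp_def, Matrix.of_apply, hM _ _ β.2]
    simp [Matrix.one_apply, Subtype.ext_iff]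
  rw [Matrix.twoBlockTriangular_det' M P, hone, Matrix.det_one, mul_one]
  · exact (Matrix.det_submatrix_equiv_self e _).symm
  · intro α hα β hβ
    rw [hM α β hβ, Matrix.one_apply_ne]
    rintro rfl
    exact hβ hα

end Kronecker

section Parametrization

variable {p : ℕ} {m : Fin p → ℕ}

/-- The multi-index with entry `a.2 + 1` in position `a.1`, and zeros elsewhere. -/
def unitIdx (a : (i : Fin p) × Fin (m i)) : (i : Fin p) → Fin (m i + 1) :=
  Function.update 0 a.1 a.2.succ

/-- The multi-index with two non-zero entries given by a pair of positions in distinct blocks. -/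
def doubleIdx (z : OffDiagIdx (fun i => m i + 1)) : (i : Fin p) → Fin (m i + 1) :=
  Function.update (unitIdx (m := m) z.1.1) z.1.2.1 (Fin.succ (z.1.2.2 : Fin (m z.1.2.1)))

theorem unitIdx_self (a : (i : Fin p) × Fin (m i)) : unitIdx a a.1 = a.2.succ :=
  Function.update_self ..

theorem unitIdx_of_ne (a : (i : Fin p) × Fin (m i)) {i : Fin p} (h : i ≠ a.1) :
    unitIdx a i = 0 :=
  Function.update_of_ne h ..

theorem unitIdx_injective : Function.Injective (unitIdx (m := m)) := by
  intro a b h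
  obtain ⟨i, a⟩ := a
  obtain ⟨j, b⟩ := b
  by_cases hij : i = j
  · subst hij
    have := congrFun h i
    rw [unitIdx_self ⟨i, a⟩, unitIdx_self ⟨i, b⟩] at this
    obtain rfl : a = b := Fin.succ_injective _ this
    rfl
  · have := congrFun h i
    rw [unitIdx_self ⟨i, a⟩, unitIdx_of_ne ⟨j, b⟩ hij] at this
    exact absurd this (Fin.succ_ne_zero a)

theorem zero_notMem_range_unitIdx : (0 : (i : Fin p) → Fin (m i + 1)) ∉ Set.range unitIdx := by
  rintro ⟨a, ha⟩
  have := congrFun ha a.1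
  rw [unitIdx_self] at this
  exact Fin.succ_ne_zero _ this

theorem notMem_range_unitIdx {α : (i : Fin p) → Fin (m i + 1)} {i j : Fin p} (hij : i ≠ j)
    (hi : α i ≠ 0) (hj : α j ≠ 0) : α ∉ Set.range unitIdx := by
  rintro ⟨a, rfl⟩
  by_cases h : i = a.1
  · exact hj (unitIdx_of_ne a (h ▸ hij.symm))
  · exact hi (unitIdx_of_ne a h)

theorem doubleIdx_fst (z : OffDiagIdx (fun i => m i + 1)) :
    doubleIdx z z.1.1.1 = Fin.succ (z.1.1.2 : Fin (m z.1.1.1)) := by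
  rw [doubleIdx, Function.update_of_ne z.2.ne, unitIdx_self]

theorem doubleIdx_snd (z : OffDiagIdx (fun i => m i + 1)) :
    doubleIdx z z.1.2.1 = Fin.succ (z.1.2.2 : Fin (m z.1.2.1)) :=
  Function.update_self ..

theorem doubleIdx_notMem_range_unitIdx (z : OffDiagIdx (fun i => m i + 1)) :
    doubleIdx z ∉ Set.range (unitIdx (m := m)) :=
  notMem_range_unitIdx z.2.ne (by rw [doubleIdx_fst]; exact Fin.succ_ne_zero _)
    (by rw [doubleIdx_snd]; exact Fin.succ_ne_zero _)

/-- The affine coordinates of the `i`-th factor: the coordinates of `q` at the unit multi-indices. -/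
def chart (q : ((i : Fin p) → Fin (m i + 1)) → ℝ) (i : Fin p) : Fin (m i) → ℝ :=
  fun a => q (unitIdx ⟨i, a⟩)

open scoped Classical in
/-- The tensor obtained from `q` by deleting the coordinates at the unit multi-indices. Thus
`core q` is the sum of a multiple of `e₀ ⊗ ⋯ ⊗ e₀` and of a tensor normal to the manifold of
rank-one tensors at `e₀ ⊗ ⋯ ⊗ e₀`. -/
noncomputable def core (q : ((i : Fin p) → Fin (m i + 1)) → ℝ) :
    ((i : Fin p) → Fin (m i + 1)) → ℝ :=
  fun α => if α ∈ Set.range unitIdx then 0 else q α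

/-- The orthogonal transformation of the space of tensors which is the tensor product of the
rotations `rot (chart q i)`. -/
noncomputable def frame (q : ((i : Fin p) → Fin (m i + 1)) → ℝ) :
    Matrix ((i : Fin p) → Fin (m i + 1)) ((i : Fin p) → Fin (m i + 1)) ℝ :=
  kron fun i => rot (chart q i)

/-- The parametrization of an open dense part of the normal bundle of the manifold of rank-one
tensors, followed by the end point map: the coordinates of `q` at the unit multi-indices determine
a rank-one line, that at `0` the position on the line, and the others a normal vector. -/
noncomputable def param (q : ((i : Fin p) → Fin (m i + 1)) → ℝ) :
    ((i : Fin p) → Fin (m i + 1)) → ℝ :=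
  (frame q).mulVec (core q)

theorem core_of_mem {q : ((i : Fin p) → Fin (m i + 1)) → ℝ} {α : (i : Fin p) → Fin (m i + 1)}
    (h : α ∈ Set.range unitIdx) : core q α = 0 := if_pos h

theorem core_of_notMem {q : ((i : Fin p) → Fin (m i + 1)) → ℝ} {α : (i : Fin p) → Fin (m i + 1)}
    (h : α ∉ Set.range unitIdx) : core q α = q α := if_neg h

theorem frame_transpose (q : ((i : Fin p) → Fin (m i + 1)) → ℝ) :
    (frame q).transpose = frame q := by
  simp only [frame, kron_transpose, rot_transpose]

theorem frame_mul_self (q : ((i : Fin p) → Fin (m i + 1)) → ℝ) : frame q * frame q = 1 := by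
  simp only [frame, kron_mul, rot_mul_self, kron_one]

theorem abs_det_frame (q : ((i : Fin p) → Fin (m i + 1)) → ℝ) : |(frame q).det| = 1 := by
  have h := congrArg Matrix.det (frame_mul_self q)
  rw [Matrix.det_mul, Matrix.det_one] at h
  have h2 : |(frame q).det| * |(frame q).det| = 1 := by rw [abs_mul_abs_self, h]
  nlinarith [abs_nonneg (frame q).det]

theorem frame_mulVec_frame_mulVec (q v : ((i : Fin p) → Fin (m i + 1)) → ℝ) :
    (frame q).mulVec ((frame q).mulVec v) = v := by
  rw [Matrix.mulVec_mulVec, frame_mul_self, Matrix.one_mulVec]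

theorem frame_mulVec_param (q : ((i : Fin p) → Fin (m i + 1)) → ℝ) :
    (frame q).mulVec (param q) = core q :=
  frame_mulVec_frame_mulVec q _

theorem dotProduct_frame_mulVec (q v w : ((i : Fin p) → Fin (m i + 1)) → ℝ) :
    (frame q).mulVec v ⬝ᵥ w = v ⬝ᵥ (frame q).mulVec w := by
  rw [Matrix.dotProduct_mulVec, ← Matrix.mulVec_transpose, frame_transpose]

theorem sum_param_sq (q : ((i : Fin p) → Fin (m i + 1)) → ℝ) :
    ∑ α, param q α ^ 2 = ∑ α, core q α ^ 2 := by
  have h : param q ⬝ᵥ param q = core q ⬝ᵥ core q := by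
    conv_lhs => rw [param, dotProduct_frame_mulVec, frame_mulVec_frame_mulVec]
  simpa only [dotProduct, ← sq] using h

theorem contDiff_param : ContDiff ℝ 1 (param (m := m)) := by
  refine contDiff_pi.2 fun α => ?_
  simp only [param, Matrix.mulVec, dotProduct]
  refine ContDiff.sum fun β _ => ContDiff.mul ?_ ?_
  · simp only [frame, kron, Matrix.of_apply]
    refine contDiff_prod fun i _ => (contDiff_rot (α i) (β i)).comp ?_
    exact contDiff_pi.2 fun a => contDiff_apply ℝ ℝ (unitIdx ⟨i, a⟩)
  · by_cases hβ : β ∈ Set.range unitIdx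
    · simp only [core_of_mem hβ]
      exact contDiff_const
    · simp only [core_of_notMem hβ]
      exact contDiff_apply ℝ ℝ β

/-- The coordinates on `W₁` of the symmetric matrix which governs the Jacobian of `param`. -/
def normalCoord (q : ((i : Fin p) → Fin (m i + 1)) → ℝ) : W1 (fun i => m i + 1) :=
  (q 0, fun z => -q (doubleIdx z))

/-- The symmetric block matrix at the coordinates `normalCoord q`, with its rows and columns indexed
by the coordinates of the charts. -/
def blockMat (q : ((i : Fin p) → Fin (m i + 1)) → ℝ) :
    Matrix ((i : Fin p) × Fin (m i)) ((i : Fin p) × Fin (m i)) ℝ :=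
  blockMatrix (normalCoord q)

theorem chart_add_unit (q : ((i : Fin p) → Fin (m i + 1)) → ℝ) (t : ℝ) (j : Fin p)
    (b : Fin (m j)) (i : Fin p) :
    chart (q + t • Pi.single (unitIdx ⟨j, b⟩) 1) i =
      Function.update (chart q) j (chart q j + t • Pi.single b 1) i := by
  ext a
  by_cases h : i = j
  · subst h
    rw [Function.update_self]
    simp only [chart, Pi.add_apply, Pi.smul_apply, Pi.single_apply]
    have : unitIdx (⟨i, a⟩ : (i : Fin p) × Fin (m i)) = unitIdx ⟨i, b⟩ ↔ a = b :=
      ⟨fun h => eq_of_heq (Sigma.mk.inj (unitIdx_injective h)).2, fun h => h ▸ rfl⟩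
    simp only [this]
  · rw [Function.update_of_ne h]
    have : unitIdx (⟨i, a⟩ : (i : Fin p) × Fin (m i)) ≠ unitIdx ⟨j, b⟩ :=
      fun h' => h (Sigma.mk.inj (unitIdx_injective h')).1
    simp [chart, this]

theorem core_add_unit (q : ((i : Fin p) → Fin (m i + 1)) → ℝ) (t : ℝ)
    (b : (i : Fin p) × Fin (m i)) : core (q + t • Pi.single (unitIdx b) 1) = core q := by
  ext α
  by_cases hα : α ∈ Set.range unitIdx
  · rw [core_of_mem hα, core_of_mem hα]
  · rw [core_of_notMem hα, core_of_notMem hα]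
    have : α ≠ unitIdx b := fun h => hα ⟨b, h.symm⟩
    simp [this]

/-- Moving `q` along a chart coordinate of the `j`-th factor. -/
theorem frame_mulVec_param_add_unit (q : ((i : Fin p) → Fin (m i + 1)) → ℝ) (t : ℝ) (j : Fin p)
    (b : Fin (m j)) (α : (i : Fin p) → Fin (m i + 1)) :
    (frame q).mulVec (param (q + t • Pi.single (unitIdx ⟨j, b⟩) 1)) α =
      ∑ c, ((rot (chart q j)).transpose * rot (chart q j + t • Pi.single b 1) :
        Matrix (Fin (m j + 1)) (Fin (m j + 1)) ℝ) (α j) c * core q (Function.update α j c) := by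
  rw [← kron_update_one_mulVec j ((rot (chart q j)).transpose *
    rot (chart q j + t • Pi.single b 1)) (core q) α, param, core_add_unit, Matrix.mulVec_mulVec, frame, frame, kron_mul]
  congr 3
  ext1 i
  rw [chart_add_unit]
  by_cases h : i = j
  · subst h
    simp only [Function.update_self, rot_transpose]
  · simp only [Function.update_of_ne h, rot_mul_self]

theorem frame_mulVec_param_add_of_notMem (q : ((i : Fin p) → Fin (m i + 1)) → ℝ) (t : ℝ)
    {β : (i : Fin p) → Fin (m i + 1)} (hβ : β ∉ Set.range (unitIdx (m := m))) :
    (frame q).mulVec (param (q + t • Pi.single β 1)) = core q + t • Pi.single β 1 := by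
  have hchart : chart (q + t • Pi.single β 1) = chart q := by
    ext i a
    have : unitIdx (⟨i, a⟩ : (i : Fin p) × Fin (m i)) ≠ β := fun h => hβ ⟨_, h⟩
    simp [chart, this]
  have hframe : frame (q + t • Pi.single β 1) = frame q := by rw [frame, hchart, frame]
  rw [param, hframe, frame_mulVec_frame_mulVec]
  ext α
  by_cases hα : α ∈ Set.range unitIdx
  · have : α ≠ β := fun h => hβ (h ▸ hα)
    simp [core_of_mem hα, this]
  · simp [core_of_notMem hα]

/-- The Jacobian matrix of `param` at `q`, in the orthonormal frame `frame q`. -/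
noncomputable def framedJac (q : ((i : Fin p) → Fin (m i + 1)) → ℝ) :
    Matrix ((i : Fin p) → Fin (m i + 1)) ((i : Fin p) → Fin (m i + 1)) ℝ :=
  frame q * LinearMap.toMatrix' (fderiv ℝ param q : _ →ₗ[ℝ] _)

/-- The columns of `framedJac q` are the velocities of `param` along coordinate lines, seen in the
frame at `q`, which stays fixed. -/
theorem hasDerivAt_framedJac (q : ((i : Fin p) → Fin (m i + 1)) → ℝ)
    (α β : (i : Fin p) → Fin (m i + 1)) :
    HasDerivAt (fun t : ℝ => (frame q).mulVec (param (q + t • Pi.single β 1)) α)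
      (framedJac q α β) 0 := by
  have hline : HasDerivAt (fun t : ℝ => q + t • Pi.single (M := fun _ => ℝ) β 1)
      (Pi.single β 1) 0 := by
    simpa using ((hasDerivAt_id (0 : ℝ)).smul_const (Pi.single (M := fun _ => ℝ) β 1)).const_add q
  have hφ : HasFDerivAt param (fderiv ℝ param q) (q + (0 : ℝ) • Pi.single β 1) := by
    rw [zero_smul, add_zero]
    exact (contDiff_param.differentiable one_ne_zero q).hasFDerivAt
  have h := hasDerivAt_pi.1 (hφ.comp_hasDerivAt (0 : ℝ) hline)
  refine (HasDerivAt.fun_sum (u := Finset.univ) fun γ _ =>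
    (h γ).const_mul (frame q α γ)).congr_deriv ?_
  simp [framedJac, Matrix.mul_apply, LinearMap.toMatrix'_apply]

theorem framedJac_of_notMem (q : ((i : Fin p) → Fin (m i + 1)) → ℝ)
    (α : (i : Fin p) → Fin (m i + 1)) {β : (i : Fin p) → Fin (m i + 1)}
    (hβ : β ∉ Set.range (unitIdx (m := m))) :
    framedJac q α β = (1 : Matrix ((i : Fin p) → Fin (m i + 1)) _ ℝ) α β := by
  refine (hasDerivAt_framedJac q α β).unique ?_
  simp only [frame_mulVec_param_add_of_notMem q _ hβ, Pi.add_apply, Pi.smul_apply]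
  refine (((hasDerivAt_id (0 : ℝ)).smul_const _).const_add _).congr_deriv ?_
  simp [Pi.single_apply, Matrix.one_apply]

/-- Along a chart coordinate of the `j`-th factor only this factor is rotated. Within the block `j`
the first column of the infinitesimal rotation acts on the coordinate at `0`; in the other blocks
its first row, which has the opposite sign, acts on the coordinates at double multi-indices. -/
theorem framedJac_unitIdx (q : ((i : Fin p) → Fin (m i + 1)) → ℝ) (a b : (i : Fin p) × Fin (m i)) :
    framedJac q (unitIdx a) (unitIdx b) =
      (blockMat q * Matrix.blockDiagonal' fun i => frameJac (chart q i)) a b := by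
  obtain ⟨i, a⟩ := a
  obtain ⟨j, b⟩ := b
  obtain ⟨A, hA, hA0, h0A⟩ := exists_hasDerivAt_frame_rot (chart q j) b
  have hL : framedJac q (unitIdx ⟨i, a⟩) (unitIdx ⟨j, b⟩) = ∑ c, A (unitIdx ⟨i, a⟩ j) c *
      core q (Function.update (unitIdx ⟨i, a⟩) j c) := by
    refine (hasDerivAt_framedJac q _ _).unique ?_
    simp only [frame_mulVec_param_add_unit]
    exact HasDerivAt.fun_sum fun c _ => (hA _ c).mul_const _
  have hR : (blockMat q * Matrix.blockDiagonal' fun i => frameJac (chart q i)) ⟨i, a⟩ ⟨j, b⟩ =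
      ∑ c, blockMat q ⟨i, a⟩ ⟨j, c⟩ *
        frameJac (chart q j) c b := by
    rw [Matrix.mul_apply, Fintype.sum_sigma, Finset.sum_eq_single j]
    · simp only [Matrix.blockDiagonal'_apply_eq]
    · intro k _ hk
      exact Finset.sum_eq_zero fun c _ => by
        rw [Matrix.blockDiagonal'_apply_ne _ _ _ hk, mul_zero]
    · exact fun h => absurd (Finset.mem_univ j) h
  rw [hL, hR, Fin.sum_univ_succ]
  by_cases hij : i = j
  · subst hij
    have h1 : Function.update (unitIdx (⟨i, a⟩ : (i : Fin p) × Fin (m i))) i 0 = 0 := by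
      rw [unitIdx, Function.update_idem]
      exact Function.update_eq_self i 0
    have h2 : ∀ c : Fin (m i), core q (Function.update (unitIdx (⟨i, a⟩ :
        (i : Fin p) × Fin (m i))) i c.succ) = 0 := by
      intro c
      refine core_of_mem ⟨⟨i, c⟩, ?_⟩
      rw [unitIdx, unitIdx, Function.update_idem]
    have h3 : ∀ c : Fin (m i), blockMat q ⟨i, a⟩ ⟨i, c⟩ = if a = c then q 0 else 0 := by
      intro c
      simp [blockMat, blockMatrix, normalCoord]
    simp only [h1, h2, h3, core_of_notMem zero_notMem_range_unitIdx, unitIdx_self ⟨i, a⟩, hA0]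
    simp [mul_comm]
  · rw [unitIdx_of_ne ⟨i, a⟩ (Ne.symm hij)]
    have h1 : core q (Function.update (unitIdx (⟨i, a⟩ : (i : Fin p) × Fin (m i))) j 0) = 0 := by
      refine core_of_mem ⟨⟨i, a⟩, ?_⟩
      rw [← unitIdx_of_ne ⟨i, a⟩ (Ne.symm hij), Function.update_eq_self]
    rw [h1, mul_zero, zero_add]
    refine Finset.sum_congr rfl fun c _ => ?_
    have h2 : core q (Function.update (unitIdx (⟨i, a⟩ : (i : Fin p) × Fin (m i))) j c.succ) =
        q (Function.update (unitIdx (⟨i, a⟩ : (i : Fin p) × Fin (m i))) j c.succ) := by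
      refine core_of_notMem (notMem_range_unitIdx hij ?_ ?_)
      · rw [Function.update_of_ne hij, unitIdx_self ⟨i, a⟩]
        exact Fin.succ_ne_zero _
      · rw [Function.update_self]
        exact Fin.succ_ne_zero _
    have h3 : blockMat q ⟨i, a⟩ ⟨j, c⟩ =
        -q (Function.update (unitIdx (⟨i, a⟩ : (i : Fin p) × Fin (m i))) j c.succ) := by
      rcases lt_or_gt_of_ne hij with h | h
      · simp only [blockMat, blockMatrix, Matrix.of_apply, dif_pos h, normalCoord, doubleIdx]
      · simp only [blockMat, blockMatrix, Matrix.of_apply, dif_neg h.not_gt, dif_pos h,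
          normalCoord, doubleIdx]
        exact congrArg (fun α => -q α) (Function.update_comm (Ne.symm hij) _ _ _)
    rw [h0A, h2, h3]
    ring

theorem abs_det_fderiv_param (q : ((i : Fin p) → Fin (m i + 1)) → ℝ) :
    |(fderiv ℝ param q).det| =
      |(blockMatrix (normalCoord q)).det| * ∏ i, (hyp (chart q i))⁻¹ ^ (m i + 1) := by
  have h1 : |(fderiv ℝ param q).det| = |(framedJac q).det| := by
    rw [framedJac, Matrix.det_mul, abs_mul, abs_det_frame, one_mul, LinearMap.det_toMatrix']
  have h2 : (framedJac q).det =
      (blockMat q * Matrix.blockDiagonal' fun i => frameJac (chart q i)).det := by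
    rw [det_eq_det_submatrix _ _ (Equiv.ofInjective _ (unitIdx_injective (m := m)))
      fun α β hβ => framedJac_of_notMem q α hβ]
    congr 1
    ext a b
    exact framedJac_unitIdx q a b
  rw [h1, h2, Matrix.det_mul, det_blockDiagonal', abs_mul, Finset.abs_prod]
  simp only [abs_det_frameJac]
  rfl

end Parametrization

end RankOneApprox

/-! ### Critical points of the distance to the rank-one tensors -/

namespace RankOneApprox

open scoped ContDiff

section Criticality

variable {p : ℕ} {n : Fin p → ℕ}

@[simp] theorem pureTensor_apply (y : (i : Fin p) → EuclideanSpace ℝ (Fin (n i)))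
    (α : (i : Fin p) → Fin (n i)) : pureTensor y α = ∏ i, y i (α i) := rfl

theorem pureTensor_update_apply (y : (i : Fin p) → EuclideanSpace ℝ (Fin (n i))) (i : Fin p)
    (h : EuclideanSpace ℝ (Fin (n i))) (α : (i : Fin p) → Fin (n i)) :
    pureTensor (Function.update y i h) α = h (α i) * ∏ j ∈ Finset.univ.erase i, y j (α j) := by
  rw [pureTensor_apply, ← Finset.mul_prod_erase _ _ (Finset.mem_univ i), Function.update_self]
  congr 1
  exact Finset.prod_congr rfl fun j hj => by
    rw [Function.update_of_ne (Finset.ne_of_mem_erase hj)]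

theorem smul_pureTensor_mem_rankOne (hp : 1 ≤ p) (y : (i : Fin p) → EuclideanSpace ℝ (Fin (n i)))
    {x : Tensor n} (hx : x ≠ 0) {c : ℝ} (hxy : ∀ α, x α = c * pureTensor y α) :
    x ∈ rankOne n := by
  refine ⟨hx, Function.update y ⟨0, hp⟩ (c • y ⟨0, hp⟩), ?_⟩
  ext α
  rw [hxy, pureTensor_update_apply, pureTensor_apply,
    ← Finset.mul_prod_erase _ _ (Finset.mem_univ (⟨0, hp⟩ : Fin p)), PiLp.smul_apply, smul_eq_mul,
    mul_assoc]

/-- The minors of order two of a tensor of rank one vanish; in particular it is determined by its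
coordinates on the axes through a multi-index `β` at which it does not vanish. -/
theorem pureTensor_mul_pow (y : (i : Fin p) → EuclideanSpace ℝ (Fin (n i)))
    (α β : (i : Fin p) → Fin (n i)) :
    pureTensor y α * pureTensor y β ^ p =
      pureTensor y β * ∏ i, pureTensor y (Function.update β i (α i)) := by
  have h : ∀ i, pureTensor y (Function.update β i (α i)) =
      y i (α i) * ∏ j ∈ Finset.univ.erase i, y j (β j) := by
    intro i
    rw [pureTensor_apply, ← Finset.mul_prod_erase _ _ (Finset.mem_univ i), Function.update_self]
    congr 1
    exact Finset.prod_congr rfl fun j hj => by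
      rw [Function.update_of_ne (Finset.ne_of_mem_erase hj)]
  have h2 : pureTensor y β ^ p =
      ∏ i, (y i (β i) * ∏ j ∈ Finset.univ.erase i, y j (β j)) := by
    rw [Finset.prod_congr rfl fun i _ => Finset.mul_prod_erase Finset.univ (fun j => y j (β j))
      (Finset.mem_univ i), Finset.prod_const, Finset.card_univ, Fintype.card_fin, pureTensor_apply]
  rw [h2, Finset.prod_congr rfl fun i _ => h i, Finset.prod_mul_distrib, Finset.prod_mul_distrib,
    pureTensor_apply, pureTensor_apply]
  ring

theorem hasDerivAt_sqDist_comp (v : Tensor n) {γ : ℝ → Tensor n} {γ' : Tensor n}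
    (hγ : ∀ α, HasDerivAt (fun t => γ t α) (γ' α) 0) :
    HasDerivAt (fun t => sqDist v (γ t)) (-2 * ∑ α, (v α - γ 0 α) * γ' α) 0 := by
  unfold sqDist
  refine (HasDerivAt.fun_sum (u := Finset.univ) fun α _ =>
    ((hγ α).const_sub (v α)).pow 2).congr_deriv ?_
  rw [Finset.mul_sum]
  refine Finset.sum_congr rfl fun α _ => ?_
  simp
  ring

/-- The tangent space of the manifold of rank-one tensors at a multiple of `y₁ ⊗ ⋯ ⊗ y_p` is
spanned by the tensors obtained by changing one of the factors. -/
theorem isCriticalPointOn_iff (hp : 1 ≤ p) (v : Tensor n)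
    (y : (i : Fin p) → EuclideanSpace ℝ (Fin (n i))) {x : Tensor n} (hx : x ≠ 0) {c : ℝ}
    (hxy : ∀ α, x α = c * pureTensor y α) :
    IsCriticalPointOn (sqDist v) (rankOne n) x ↔
      ∀ i h, ∑ α, (v α - x α) * pureTensor (Function.update y i h) α = 0 := by
  have hc : c ≠ 0 := by
    rintro rfl
    exact hx (by ext α; simp [hxy])
  constructor
  · rintro ⟨-, hcrit⟩ i h
    set T : Tensor n := pureTensor (Function.update y i h) with hT
    have hγ : ContDiff ℝ ∞ (fun t : ℝ => x + t • T) := by fun_prop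
    have hmem : ∀ᶠ t in nhds (0 : ℝ), x + t • T ∈ rankOne n := by
      have hne : ∀ᶠ t in nhds (0 : ℝ), x + t • T ≠ 0 :=
        hγ.continuous.continuousAt.eventually_ne (by simpa using hx)
      filter_upwards [hne] with t ht
      refine smul_pureTensor_mem_rankOne hp (Function.update y i (y i + (t / c) • h)) ht
        (c := c) fun α => ?_
      rw [PiLp.add_apply, PiLp.smul_apply, hxy, hT, pureTensor_update_apply,
        pureTensor_update_apply, pureTensor_apply,
        ← Finset.mul_prod_erase _ _ (Finset.mem_univ i), PiLp.add_apply, PiLp.smul_apply,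
        smul_eq_mul, smul_eq_mul]
      field_simp
    have h1 := hcrit _ hγ (by simp) hmem
    have h2 : HasDerivAt (fun t : ℝ => sqDist v (x + t • T))
        (-2 * ∑ α, (v α - (x + (0 : ℝ) • T) α) * T α) 0 := by
      refine hasDerivAt_sqDist_comp v fun α => ?_
      simpa using ((hasDerivAt_id (0 : ℝ)).mul_const (T α)).const_add (x α)
    have h3 := h2.unique h1
    simpa using h3
  · intro horth
    refine ⟨smul_pureTensor_mem_rankOne hp y hx hxy, fun γ hγ hγ0 hmem => ?_⟩
    set γ' : Tensor n := deriv γ 0 with hγ'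
    have hd : ∀ α, HasDerivAt (fun t => γ t α) (γ' α) 0 := by
      have h0 : HasDerivAt γ γ' 0 :=
        (hγ.differentiable (by simp) (0 : ℝ)).hasDerivAt
      intro α
      exact (PiLp.hasFDerivAt_apply (𝕜 := ℝ) 2 (γ 0) α).comp_hasDerivAt (0 : ℝ) h0
    suffices hzero : ∑ α, (v α - x α) * γ' α = 0 by
      have h1 := hasDerivAt_sqDist_comp v hd
      rwa [hγ0, hzero, mul_zero] at h1
    obtain ⟨β, hβ⟩ : ∃ β, x β ≠ 0 := by
      by_contra! h
      exact hx (by ext α; simpa using h α)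
    have hyβ : ∀ j, y j (β j) ≠ 0 := by
      intro j hj
      refine hβ ?_
      rw [hxy, pureTensor_apply, Finset.prod_eq_zero (Finset.mem_univ j) hj, mul_zero]
    have hax : ∀ i a, x (Function.update β i a) = x β / y i (β i) * y i a := by
      intro i a
      have h1 : pureTensor y β = y i (β i) * ∏ j ∈ Finset.univ.erase i, y j (β j) :=
        (Finset.mul_prod_erase _ _ (Finset.mem_univ i)).symm
      have h2 : pureTensor y (Function.update β i a) =
          y i a * ∏ j ∈ Finset.univ.erase i, y j (β j) := by
        rw [pureTensor_apply, ← Finset.mul_prod_erase _ _ (Finset.mem_univ i),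
          Function.update_self]
        congr 1
        exact Finset.prod_congr rfl fun j hj => by
          rw [Function.update_of_ne (Finset.ne_of_mem_erase hj)]
      rw [hxy, hxy, h1, h2]
      field_simp [hyβ i]
    -- differentiate the relation between the coordinates of a tensor of rank one along the curve
    have hrel : ∀ α, (fun t => γ t α * γ t β ^ p) =ᶠ[nhds 0]
        fun t => γ t β * ∏ i, γ t (Function.update β i (α i)) := by
      intro α
      filter_upwards [hmem] with t ht
      obtain ⟨-, w, hw⟩ := ht
      rw [hw]
      exact pureTensor_mul_pow w α β
    have hxrel : ∀ α, x α * x β ^ p = x β * ∏ i, x (Function.update β i (α i)) := by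
      intro α
      simpa only [hγ0] using (hrel α).eq_of_nhds
    set T : Fin p → Tensor n := fun i => pureTensor (Function.update y i
      (WithLp.toLp 2 fun a => γ' (Function.update β i a))) with hT
    set e : Fin p → ℝ := fun i => ∏ j ∈ Finset.univ.erase i, (x β / y j (β j)) with he
    have hder : ∀ α, γ' α * x β ^ p =
        (x β ^ p / x β * γ' β - p * x β ^ (p - 1) * γ' β) * x α + ∑ i, x β * e i * T i α := by
      intro α
      have h1 := (hd α).mul ((hd β).pow p)
      have h2 := (hd β).mul (HasDerivAt.fun_finsetProd (u := Finset.univ)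
        fun i _ => hd (Function.update β i (α i)))
      have h3 := h1.unique (h2.congr_of_eventuallyEq (hrel α))
      simp only [Pi.pow_apply, hγ0, smul_eq_mul] at h3
      have h4 : ∏ i, x (Function.update β i (α i)) = x α * x β ^ p / x β := by
        rw [hxrel]
        field_simp
      have h5 : ∀ i, (∏ j ∈ Finset.univ.erase i, x (Function.update β j (α j))) *
          γ' (Function.update β i (α i)) = e i * T i α := by
        intro i
        simp only [hax, hT, he, Finset.prod_mul_distrib, pureTensor_update_apply]
        ring
      rw [h4, Finset.sum_congr rfl fun i _ => h5 i, Finset.mul_sum] at h3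
      simp only [← mul_assoc] at h3
      linear_combination h3
    have hx0 : ∑ α, (v α - x α) * x α = 0 := by
      have := horth ⟨0, hp⟩ (y ⟨0, hp⟩)
      rw [Function.update_eq_self] at this
      rw [← mul_zero c, ← this, Finset.mul_sum]
      exact Finset.sum_congr rfl fun α _ => by rw [hxy α]; ring
    have hfin : (∑ α, (v α - x α) * γ' α) * x β ^ p = 0 := by
      rw [Finset.sum_mul]
      calc ∑ α, (v α - x α) * γ' α * x β ^ p
          = ∑ α, ((x β ^ p / x β * γ' β - p * x β ^ (p - 1) * γ' β) * ((v α - x α) * x α) +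
              ∑ i, x β * e i * ((v α - x α) * T i α)) := by
            refine Finset.sum_congr rfl fun α _ => ?_
            rw [mul_assoc, hder α, mul_add, Finset.mul_sum]
            congr 1
            · ring
            · exact Finset.sum_congr rfl fun i _ => by ring
        _ = 0 := by
            rw [Finset.sum_add_distrib, ← Finset.mul_sum, hx0, mul_zero, zero_add,
              Finset.sum_comm]
            refine Finset.sum_eq_zero fun i _ => ?_
            rw [← Finset.mul_sum, horth i, mul_zero]
    exact (mul_eq_zero.1 hfin).resolve_right (pow_ne_zero p hβ)

end Criticality

end RankOneApprox

/-! ### Critical points as a fiber of the end point map -/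

namespace RankOneApprox

section Counting

variable {p : ℕ} {m : Fin p → ℕ}

/-- The rank-one tensor from which the end point map `param` departs. -/
noncomputable def footpoint (q : ((i : Fin p) → Fin (m i + 1)) → ℝ) : Tensor (fun i => m i + 1) :=
  WithLp.toLp 2 fun α => q 0 * ∏ i, unitVec (chart q i) (α i)

theorem footpoint_apply (q : ((i : Fin p) → Fin (m i + 1)) → ℝ) (α : (i : Fin p) → Fin (m i + 1)) :
    footpoint q α = q 0 * ∏ i, unitVec (chart q i) (α i) := rfl

theorem frame_apply_zero (q : ((i : Fin p) → Fin (m i + 1)) → ℝ)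
    (α : (i : Fin p) → Fin (m i + 1)) : frame q α 0 = ∏ i, unitVec (chart q i) (α i) := by
  simp only [frame, kron, Matrix.of_apply, Pi.zero_apply, rot_apply_zero]

theorem frame_apply_update (q : ((i : Fin p) → Fin (m i + 1)) → ℝ)
    (α : (i : Fin p) → Fin (m i + 1)) (i : Fin p) (a : Fin (m i + 1)) :
    frame q α (Function.update 0 i a) =
      rot (chart q i) (α i) a * ∏ j ∈ Finset.univ.erase i, unitVec (chart q j) (α j) := by
  rw [frame, kron, Matrix.of_apply, ← Finset.mul_prod_erase _ _ (Finset.mem_univ i),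
    Function.update_self]
  congr 1
  exact Finset.prod_congr rfl fun j hj => by
    rw [Function.update_of_ne (Finset.ne_of_mem_erase hj), Pi.zero_apply, rot_apply_zero]

theorem footpoint_zero_ne {q : ((i : Fin p) → Fin (m i + 1)) → ℝ} (hq : q 0 ≠ 0) :
    footpoint q 0 ≠ 0 := by
  rw [footpoint_apply]
  exact mul_ne_zero hq (Finset.prod_ne_zero_iff.2 fun i _ => (unitVec_zero_pos _).ne')

/-- The tangent space at `footpoint q` is spanned by the columns of `frame q` whose indices have at
most one non-zero entry. -/
theorem isCriticalPointOn_footpoint_iff (hp : 1 ≤ p) (v : ((i : Fin p) → Fin (m i + 1)) → ℝ)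
    {q : ((i : Fin p) → Fin (m i + 1)) → ℝ} (hq : q 0 ≠ 0) :
    IsCriticalPointOn (sqDist (WithLp.toLp 2 v)) (rankOne fun i => m i + 1) (footpoint q) ↔
      (frame q).mulVec v 0 = q 0 ∧ ∀ a, (frame q).mulVec v (unitIdx a) = 0 := by
  set u : (i : Fin p) → EuclideanSpace ℝ (Fin (m i + 1)) :=
    fun i => WithLp.toLp 2 (unitVec (chart q i)) with hu
  have hne : footpoint q ≠ 0 := fun h => footpoint_zero_ne hq (by rw [h]; rfl)
  rw [isCriticalPointOn_iff hp _ u hne (c := q 0) fun α => rfl]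
  have hfoot : (frame q).mulVec (footpoint q).ofLp = q 0 • Pi.single 0 1 := by
    have : (footpoint q).ofLp = (frame q).mulVec (q 0 • Pi.single 0 1) := by
      ext α
      rw [footpoint_apply, ← frame_apply_zero, Matrix.mulVec_smul, Matrix.mulVec_single_one]
      rfl
    rw [this, frame_mulVec_frame_mulVec]
  have hcol : ∀ i a, ∑ α, (v α - footpoint q α) * frame q α (Function.update 0 i a) =
      (frame q).mulVec v (Function.update 0 i a) -
        if a = 0 then q 0 else 0 := by
    intro i a
    have h1 : (if a = 0 then q 0 else 0) =
        (frame q).mulVec (footpoint q).ofLp (Function.update 0 i a) := by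
      rw [hfoot]
      by_cases ha : a = 0
      · subst ha
        have : Function.update (0 : (i : Fin p) → Fin (m i + 1)) i 0 = 0 :=
          Function.update_eq_self i _
        simp [this]
      · have : Function.update (0 : (i : Fin p) → Fin (m i + 1)) i a ≠ 0 := fun h => ha (by
          simpa using congrFun h i)
        simp [this, ha]
    rw [h1, ← Pi.sub_apply ((frame q).mulVec v), ← Matrix.mulVec_sub, Matrix.mulVec, dotProduct]
    refine Finset.sum_congr rfl fun α _ => ?_
    rw [mul_comm]
    congr 1
    exact congrFun (congrFun (frame_transpose q) _) α
  have hequiv : (∀ i h, ∑ α, (v α - footpoint q α) * pureTensor (Function.update u i h) α = 0) ↔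
      ∀ i a, ∑ α, (v α - footpoint q α) * frame q α (Function.update 0 i a) = 0 := by
    constructor
    · intro h i a
      rw [← h i (WithLp.toLp 2 fun b => rot (chart q i) b a)]
      refine Finset.sum_congr rfl fun α _ => ?_
      rw [frame_apply_update, pureTensor_update_apply]
    · intro h i w
      set k := (rot (chart q i)).mulVec w.ofLp with hk
      have hw : ∀ b, w b = ∑ a, rot (chart q i) b a * k a := by
        intro b
        change _ = (rot (chart q i)).mulVec k b
        rw [hk, Matrix.mulVec_mulVec, rot_mul_self, Matrix.one_mulVec]
      have hT : ∀ α, pureTensor (Function.update u i w) α =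
          ∑ a, k a * frame q α (Function.update 0 i a) := by
        intro α
        rw [pureTensor_update_apply, hw, Finset.sum_mul]
        refine Finset.sum_congr rfl fun a _ => ?_
        rw [frame_apply_update]
        ring
      simp only [hT, Finset.mul_sum]
      rw [Finset.sum_comm]
      refine Finset.sum_eq_zero fun a _ => ?_
      rw [← mul_zero (k a), ← h i a, Finset.mul_sum]
      exact Finset.sum_congr rfl fun α _ => by ring
  refine hequiv.trans ?_
  simp only [hcol, sub_eq_zero]
  constructor
  · intro h
    refine ⟨?_, fun a => ?_⟩
    · have := h ⟨0, hp⟩ 0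
      rwa [if_pos rfl, show Function.update (0 : (i : Fin p) → Fin (m i + 1)) ⟨0, hp⟩ 0 = 0 from
        Function.update_eq_self _ _] at this
    · have := h a.1 a.2.succ
      rwa [if_neg (Fin.succ_ne_zero _)] at this
  · rintro ⟨h0, h1⟩ i a
    refine Fin.cases ?_ (fun a => ?_) a
    · rwa [if_pos rfl, show Function.update (0 : (i : Fin p) → Fin (m i + 1)) i 0 = 0 from
        Function.update_eq_self _ _]
    · rw [if_neg (Fin.succ_ne_zero _)]
      exact h1 ⟨i, a⟩

theorem eq_of_chart_eq_of_core_eq {q q' : ((i : Fin p) → Fin (m i + 1)) → ℝ}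
    (hchart : chart q = chart q') (hcore : core q = core q') : q = q' := by
  ext α
  by_cases hα : α ∈ Set.range unitIdx
  · obtain ⟨a, rfl⟩ := hα
    exact congrFun (congrFun hchart a.1) a.2
  · rw [← core_of_notMem (q := q) hα, hcore, core_of_notMem hα]

theorem footpoint_unitIdx (q : ((i : Fin p) → Fin (m i + 1)) → ℝ) (a : (i : Fin p) × Fin (m i)) :
    footpoint q (unitIdx a) = footpoint q 0 * chart q a.1 a.2 := by
  have h1 : ∀ α : (i : Fin p) → Fin (m i + 1), footpoint q α = q 0 *
      (unitVec (chart q a.1) (α a.1) *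
        ∏ j ∈ Finset.univ.erase a.1, unitVec (chart q j) (α j)) := fun α => by
    rw [footpoint_apply, ← Finset.mul_prod_erase _ _ (Finset.mem_univ a.1)]
  rw [h1, h1, unitIdx_self, Finset.prod_congr rfl fun j hj => by
    rw [unitIdx_of_ne a (Finset.ne_of_mem_erase hj)]]
  simp only [Pi.zero_apply, unitVec_zero, unitVec_succ]
  ring

/-- Every rank-one tensor with non-zero `0`-coordinate is a foot point, and the base point and
fiber coordinates are determined by it and by the end point. -/
theorem bijOn_footpoint (hp : 1 ≤ p) (v : ((i : Fin p) → Fin (m i + 1)) → ℝ) :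
    Set.BijOn footpoint {q | q ∈ {q | q 0 ≠ 0} ∧ param q = v}
      {x | IsCriticalPointOn (sqDist (WithLp.toLp 2 v)) (rankOne fun i => m i + 1) x ∧
        x 0 ≠ 0} := by
  refine ⟨?_, ?_, ?_⟩
  · rintro q ⟨hq, rfl⟩
    refine ⟨(isCriticalPointOn_footpoint_iff hp _ hq).2 ?_, footpoint_zero_ne hq⟩
    rw [frame_mulVec_param]
    exact ⟨core_of_notMem zero_notMem_range_unitIdx, fun a => core_of_mem ⟨a, rfl⟩⟩
  · rintro q ⟨hq, hqv⟩ q' ⟨hq', hqv'⟩ h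
    have hchart : chart q = chart q' := by
      ext i a
      have h1 := footpoint_unitIdx q ⟨i, a⟩
      rw [h, footpoint_unitIdx q' ⟨i, a⟩] at h1
      exact (mul_left_cancel₀ (footpoint_zero_ne hq') h1).symm
    refine eq_of_chart_eq_of_core_eq hchart ?_
    rw [← frame_mulVec_param, ← frame_mulVec_param, hqv, hqv', frame, hchart, frame]
  · rintro x ⟨hx, hx0⟩
    obtain ⟨y, hy⟩ := hx.1.2
    have hy0 : ∀ i, y i 0 ≠ 0 := by
      intro i hi
      refine hx0 ?_
      rw [hy, pureTensor_apply]
      exact Finset.prod_eq_zero (Finset.mem_univ i) hi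
    set z : (i : Fin p) → Fin (m i) → ℝ := fun i a => y i a.succ / y i 0 with hz
    set F := kron fun i => rot (z i) with hF
    classical
    -- the fiber coordinates are read off from `v` in the frame, except at `0`: the value there has
    -- to be non-zero before criticality of `x` can be expressed in the frame
    set q : ((i : Fin p) → Fin (m i + 1)) → ℝ := fun α =>
      if h : α ∈ Set.range unitIdx then z h.choose.1 h.choose.2 else
        if α = 0 then ∏ i, y i 0 * hyp (z i) else F.mulVec v α with hqdef
    have hchart : chart q = z := by
      ext i a
      have hmem : unitIdx (⟨i, a⟩ : (i : Fin p) × Fin (m i)) ∈ Set.range unitIdx := ⟨_, rfl⟩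
      simp only [chart, hqdef, dif_pos hmem]
      rw [unitIdx_injective hmem.choose_spec]
    have hq0 : q 0 = ∏ i, y i 0 * hyp (z i) :=
      (dif_neg zero_notMem_range_unitIdx).trans (if_pos rfl)
    have hq0' : q 0 ≠ 0 := by
      rw [hq0]
      exact Finset.prod_ne_zero_iff.2 fun i _ => mul_ne_zero (hy0 i) (hyp_pos _).ne'
    have hframe : frame q = F := by rw [frame, hchart]
    have hfoot : footpoint q = x := by
      ext α
      rw [footpoint_apply, hq0, hchart, ← Finset.prod_mul_distrib, hy, pureTensor_apply]
      refine Finset.prod_congr rfl fun i _ => ?_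
      have h1 := (hyp_pos (z i)).ne'
      have h2 := hy0 i
      refine Fin.cases ?_ (fun a => ?_) (α i)
      · rw [unitVec_zero]
        field_simp
      · have h3 : z i a * y i 0 = y i a.succ := div_mul_cancel₀ _ h2
        rw [unitVec_succ, ← h3]
        field_simp
    obtain ⟨h0, h1⟩ := (isCriticalPointOn_footpoint_iff hp v hq0').1 (hfoot ▸ hx)
    refine ⟨q, ⟨hq0', ?_⟩, hfoot⟩
    have hcore : core q = (frame q).mulVec v := by
      ext α
      by_cases hα : α ∈ Set.range unitIdx
      · rw [core_of_mem hα]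
        obtain ⟨a, rfl⟩ := hα
        exact (h1 a).symm
      · rw [core_of_notMem hα]
        by_cases hα0 : α = 0
        · rw [hα0, h0]
        · simp only [hqdef, dif_neg hα, if_neg hα0]
          rw [hframe]
    rw [param, hcore, frame_mulVec_frame_mulVec]

/-- Permuting the values of the indices, independently in each factor, permutes the critical
points. -/
theorem IsCriticalPointOn.comp_perm {v x : Tensor (fun i => m i + 1)}
    (hx : IsCriticalPointOn (sqDist v) (rankOne fun i => m i + 1) x)
    (σ : (i : Fin p) → Equiv.Perm (Fin (m i + 1))) (hσ : ∀ i a, σ i (σ i a) = a) :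
    IsCriticalPointOn (sqDist (WithLp.toLp 2 fun α => v fun i => σ i (α i)))
      (rankOne fun i => m i + 1) (WithLp.toLp 2 fun α => x fun i => σ i (α i)) := by
  set T : Tensor (fun i => m i + 1) → Tensor (fun i => m i + 1) :=
    fun x => WithLp.toLp 2 fun α => x fun i => σ i (α i) with hT
  have hTapp : ∀ x α, T x α = x fun i => σ i (α i) := fun _ _ => rfl
  have hTT : ∀ x, T (T x) = x := by
    intro x
    ext α
    simp only [hTapp, hσ]
  have hT0 : T 0 = 0 := rfl
  have hTmem : ∀ x ∈ rankOne (fun i => m i + 1), T x ∈ rankOne fun i => m i + 1 := by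
    rintro x ⟨hx0, y, rfl⟩
    refine ⟨fun h => hx0 ?_, fun i => WithLp.toLp 2 fun a => y i (σ i a), rfl⟩
    rw [← hTT (pureTensor y), h, hT0]
  have hdist : ∀ x, sqDist (T v) x = sqDist v (T x) := by
    intro x
    let e : ((i : Fin p) → Fin (m i + 1)) ≃ ((i : Fin p) → Fin (m i + 1)) := Equiv.piCongrRight σ
    refine Fintype.sum_equiv e _ _ fun α => ?_
    have he : T x (e α) = x α := by
      rw [hTapp]
      exact congrArg x.ofLp (funext fun i => hσ i (α i))
    rw [he]
    rfl
  change IsCriticalPointOn (sqDist (T v)) _ (T x)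
  refine ⟨hTmem x hx.1, fun γ hγ hγ0 hmem => ?_⟩
  simp only [hdist]
  refine hx.2 (fun t => T (γ t)) ?_ ?_ ?_
  · rw [contDiff_euclidean] at hγ ⊢
    exact fun α => hγ _
  · simp only [hγ0, hTT]
  · filter_upwards [hmem] with t ht using hTmem _ ht

open MeasureTheory in
/-- A critical point with vanishing `0`-coordinate becomes, after exchanging `0` with the entries
of a multi-index at which it does not vanish, a foot point with a vanishing chart coordinate; the
end points of these form a null set. -/
theorem ae_critical_zero_ne (hp : 1 ≤ p) :
    ∀ᵐ v : ((i : Fin p) → Fin (m i + 1)) → ℝ, ∀ x,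
      IsCriticalPointOn (sqDist (WithLp.toLp 2 v)) (rankOne fun i => m i + 1) x → x 0 ≠ 0 := by
  set Z : Set (((i : Fin p) → Fin (m i + 1)) → ℝ) := ⋃ a, {q | q (unitIdx a) = 0} with hZ
  have hZ0 : volume Z = 0 := by
    rw [hZ, measure_iUnion_null_iff]
    exact fun a => Measure.pi_hyperplane _ (unitIdx a) 0
  set σ : ((i : Fin p) → Fin (m i + 1)) → (i : Fin p) → Equiv.Perm (Fin (m i + 1)) :=
    fun β i => Equiv.swap 0 (β i) with hσ
  set ψ : ((i : Fin p) → Fin (m i + 1)) → (((i : Fin p) → Fin (m i + 1)) → ℝ) →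
    ((i : Fin p) → Fin (m i + 1)) → ℝ := fun β q α => param q fun i => σ β i (α i) with hψ
  have hnull : ∀ β, volume (ψ β '' Z) = 0 := by
    intro β
    refine addHaar_image_eq_zero_of_differentiableOn_of_addHaar_eq_zero volume
      (Differentiable.differentiableOn ?_) hZ0
    have h1 := differentiable_pi.1 (contDiff_param (m := m).differentiable one_ne_zero)
    exact differentiable_pi.2 fun α => h1 _
  have hU : volume (⋃ β, ψ β '' Z) = 0 := measure_iUnion_null_iff.2 hnull
  filter_upwards [compl_mem_ae_iff.2 hU] with v hv x hx hx0
  obtain ⟨β, hβ⟩ : ∃ β, x β ≠ 0 := by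
    by_contra! h
    exact hx.1.1 (by ext α; simpa using h α)
  have hinv : ∀ i a, σ β i (σ β i a) = a := fun i a => Equiv.swap_apply_self ..
  have hx' := hx.comp_perm (σ β) hinv
  obtain ⟨q, ⟨hq, hqv⟩, hqx⟩ := (bijOn_footpoint hp _).2.2 ⟨hx', by
    simpa [hσ] using hβ⟩
  refine hv (Set.mem_iUnion.2 ⟨β, q, ?_, ?_⟩)
  · have h1 : footpoint q β = 0 := by
      rw [hqx]
      exact (congrArg x.ofLp (funext fun i => Equiv.swap_apply_right ..)).trans hx0
    rw [footpoint_apply] at h1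
    obtain ⟨i, -, hi⟩ := Finset.prod_eq_zero_iff.1 ((mul_eq_zero.1 h1).resolve_left hq)
    obtain ⟨a, ha⟩ : ∃ a : Fin (m i), a.succ = β i := by
      refine Fin.exists_succ_eq.2 fun h0 => ?_
      rw [h0] at hi
      exact (unitVec_zero_pos _).ne' hi
    rw [← ha, unitVec_succ, div_eq_zero_iff] at hi
    exact Set.mem_iUnion.2 ⟨⟨i, a⟩, hi.resolve_right (hyp_pos _).ne'⟩
  · ext α
    simp only [hψ, hqv, hinv]

open MeasureTheory in
theorem critCount_ae_eq (hp : 1 ≤ p) :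
    (fun v : ((i : Fin p) → Fin (m i + 1)) → ℝ =>
      critCount (WithLp.toLp 2 v : Tensor fun i => m i + 1)) =ᵐ[volume]
        fiberCount param {q | q 0 ≠ 0} := by
  filter_upwards [ae_critical_zero_ne (m := m) hp] with v hv
  rw [critCount, fiberCount, ← (bijOn_footpoint hp v).injOn.encard_image,
    (bijOn_footpoint hp v).image_eq]
  congr 3
  ext x
  exact ⟨fun h => ⟨h, hv x h⟩, fun h => h.1⟩

end Counting

end RankOneApprox

/-! ### Gaussian product measures and the volume of projective space -/

namespace RankOneApprox

open MeasureTheory ProbabilityTheory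

section ProductMeasures

theorem lintegral_ofReal_prod {ι : Type*} [Fintype ι] {E : ι → Type*} [∀ i, MeasurableSpace (E i)]
    {μ : ∀ i, Measure (E i)} [∀ i, SigmaFinite (μ i)] {f : ∀ i, E i → ℝ}
    (hf : ∀ i, Integrable (f i) (μ i)) (hf0 : ∀ i x, 0 ≤ f i x) :
    ∫⁻ x, ENNReal.ofReal (∏ i, f i (x i)) ∂Measure.pi μ =
      ENNReal.ofReal (∏ i, ∫ x, f i x ∂μ i) := by
  rw [← integral_fintype_prod_eq_prod, ofReal_integral_eq_lintegral_ofReal]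
  · exact Integrable.fintype_prod_dep hf
  · exact Filter.Eventually.of_forall fun x => Finset.prod_nonneg fun i _ => hf0 i _

/-- The standard Gaussian measure on a finite power of `ℝ` has as its density the product of the
densities of the factors. -/
theorem pi_gaussianReal_eq_withDensity (τ : Type*) [Fintype τ] :
    Measure.pi (fun _ : τ => gaussianReal 0 1) =
      volume.withDensity fun w => ENNReal.ofReal (∏ t, gaussianPDFReal 0 1 (w t)) := by
  refine Measure.pi_eq fun s hs => ?_
  rw [withDensity_apply _ (MeasurableSet.univ_pi hs), volume_pi, Measure.restrict_pi_pi,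
    lintegral_ofReal_prod (fun t => (integrable_gaussianPDFReal 0 1).restrict)
      fun t => gaussianPDFReal_nonneg 0 1, ENNReal.ofReal_prod_of_nonneg]
  · exact Finset.prod_congr rfl fun t _ =>
      (gaussianReal_apply_eq_integral 0 one_ne_zero (s t)).symm
  · exact fun t _ => integral_nonneg (gaussianPDFReal_nonneg 0 1)

/-- Choosing some of the coordinates of a random vector with independent, identically distributed
coordinates. -/
theorem measurePreserving_select {τ κ : Type*} [Fintype τ] [Fintype κ] {μ : Measure ℝ}
    [IsProbabilityMeasure μ] {f : ℝ → ℝ} (hf : MeasurePreserving f μ μ) {g : κ → τ}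
    (hg : Function.Injective g) :
    MeasurePreserving (fun (w : τ → ℝ) k => f (w (g k))) (Measure.pi fun _ => μ)
      (Measure.pi fun _ => μ) := by
  have hfm := hf.measurable
  refine ⟨by fun_prop, ?_⟩
  have hind : iIndepFun (fun t (w : τ → ℝ) => f (w t)) (Measure.pi fun _ => μ) :=
    iIndepFun_pi (μ := fun _ : τ => μ) fun _ => hfm.aemeasurable
  refine ((hind.precomp hg).map_fun_eq_pi_map fun k =>
    (hfm.comp (measurable_pi_apply (g k))).aemeasurable).trans ?_
  congr 1
  ext1 k
  exact (hf.comp (measurePreserving_eval (fun _ : τ => μ) (g k))).map_eq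

theorem measurePreserving_sigma_uncurry {ι τ : Type*} [Fintype ι] {κ : ι → Type*}
    [∀ i, Fintype (κ i)] [Fintype τ] (e : ((i : ι) × κ i) ≃ τ) :
    MeasurePreserving (fun (y : (i : ι) → κ i → ℝ) (t : τ) => y (e.symm t).1 (e.symm t).2) := by
  refine ⟨by fun_prop, (Measure.pi_eq fun s hs => ?_).symm⟩
  rw [Measure.map_apply (by fun_prop) (MeasurableSet.univ_pi hs)]
  have hpre : (fun (y : (i : ι) → κ i → ℝ) (t : τ) => y (e.symm t).1 (e.symm t).2) ⁻¹'
      Set.univ.pi s = Set.univ.pi fun i => Set.univ.pi fun a => s (e ⟨i, a⟩) := by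
    ext y
    simp only [Set.mem_preimage, Set.mem_univ_pi]
    constructor
    · intro h i a
      have := h (e ⟨i, a⟩)
      rwa [e.symm_apply_apply] at this
    · intro h t
      simpa using h (e.symm t).1 (e.symm t).2
  rw [hpre, volume_pi_pi, Finset.prod_congr rfl fun i _ => volume_pi_pi _,
    ← Fintype.prod_sigma' fun i a => volume (s (e ⟨i, a⟩))]
  exact Fintype.prod_equiv e _ _ fun _ => rfl

end ProductMeasures

section ProjectiveVolume

theorem hyp_pow_eq {m : ℕ} (y : Fin m → ℝ) :
    (hyp y)⁻¹ ^ (m + 1) = (1 / (1 + ∑ a, y a ^ 2)) ^ (((m : ℝ) + 1) / 2) := by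
  rw [← hyp_sq, ← Real.rpow_natCast, one_div, ← inv_pow, ← Real.rpow_natCast (hyp y)⁻¹ 2,
    ← Real.rpow_mul (inv_nonneg.2 (hyp_pos y).le)]
  congr 1
  push_cast
  ring

theorem measurable_hyp {m : ℕ} : Measurable (hyp : (Fin m → ℝ) → ℝ) :=
  contDiff_hyp.continuous.measurable

/-- The volume of the real projective space of dimension `m`, computed in an affine chart. The
integrand is written as a superposition of Gaussian functions by means of the integral which
defines the Gamma function. -/
theorem lintegral_hyp_pow (m : ℕ) :
    ∫⁻ y : Fin m → ℝ, ENNReal.ofReal ((hyp y)⁻¹ ^ (m + 1)) =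
      ENNReal.ofReal (Real.pi ^ (((m : ℝ) + 1) / 2) / Real.Gamma (((m : ℝ) + 1) / 2)) := by
  set a : ℝ := ((m : ℝ) + 1) / 2 with ha
  have ha0 : 0 < a := by positivity
  have hΓ := Real.Gamma_pos_of_pos ha0
  have hpt : ∀ y : Fin m → ℝ, ENNReal.ofReal ((hyp y)⁻¹ ^ (m + 1)) =
      ENNReal.ofReal (Real.Gamma a)⁻¹ * ∫⁻ t in Set.Ioi (0 : ℝ),
        ENNReal.ofReal (t ^ (a - 1) * Real.exp (-((1 + ∑ i, y i ^ 2) * t))) := by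
    intro y
    have hr : 0 < 1 + ∑ i, y i ^ 2 := by positivity
    have hint := Real.integral_rpow_mul_exp_neg_mul_Ioi ha0 hr
    rw [← ofReal_integral_eq_lintegral_ofReal, hint, ← ENNReal.ofReal_mul (by positivity),
      hyp_pow_eq, ← ha]
    · congr 1
      field_simp
    · refine Integrable.of_integral_ne_zero ?_
      rw [hint]
      positivity
    · refine (ae_restrict_mem measurableSet_Ioi).mono fun t ht => ?_
      have : (0 : ℝ) < t := ht
      positivity
  have hgauss : ∀ t ∈ Set.Ioi (0 : ℝ), ∫⁻ y : Fin m → ℝ,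
      ENNReal.ofReal (t ^ (a - 1) * Real.exp (-((1 + ∑ i, y i ^ 2) * t))) =
        ENNReal.ofReal (Real.pi ^ ((m : ℝ) / 2) *
          (t ^ ((1 / 2 : ℝ) - 1) * Real.exp (-(1 * t)))) := by
    intro t ht
    have ht0 : (0 : ℝ) < t := ht
    have hfac : ∀ y : Fin m → ℝ,
        ENNReal.ofReal (t ^ (a - 1) * Real.exp (-((1 + ∑ i, y i ^ 2) * t))) =
          ENNReal.ofReal (t ^ (a - 1) * Real.exp (-t)) *
            ENNReal.ofReal (∏ i, Real.exp (-t * y i ^ 2)) := by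
      intro y
      rw [← ENNReal.ofReal_mul (by positivity), ← Real.exp_sum, mul_assoc, ← Real.exp_add,
        ← Finset.mul_sum]
      congr 3
      ring
    simp only [hfac]
    rw [lintegral_const_mul _ (by fun_prop), volume_pi,
      lintegral_ofReal_prod (fun _ => integrable_exp_neg_mul_sq ht0) fun _ _ => (Real.exp_pos _).le,
      ← ENNReal.ofReal_mul (by positivity)]
    congr 1
    rw [integral_gaussian, Finset.prod_const, Finset.card_univ, Fintype.card_fin, Real.sqrt_eq_rpow,
      ← Real.rpow_natCast, ← Real.rpow_mul (by positivity), Real.div_rpow Real.pi_pos.le ht0.le,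
      show t ^ (a - 1) = t ^ ((1 / 2 : ℝ) - 1) * t ^ (1 / 2 * (m : ℝ)) by
        rw [← Real.rpow_add ht0]; congr 1; rw [ha]; ring,
      show (m : ℝ) / 2 = 1 / 2 * m by ring]
    field_simp
  simp only [hpt]
  rw [lintegral_const_mul' _ _ ENNReal.ofReal_ne_top, lintegral_lintegral_swap (by fun_prop),
    setLIntegral_congr_fun measurableSet_Ioi hgauss]
  have hint := Real.integral_rpow_mul_exp_neg_mul_Ioi (a := 1 / 2) (r := 1) (by norm_num)
    one_pos
  rw [← ofReal_integral_eq_lintegral_ofReal, integral_const_mul, hint, Real.Gamma_one_half_eq,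
    ← ENNReal.ofReal_mul (by positivity)]
  · congr 1
    rw [ha, Real.sqrt_eq_rpow, add_div, Real.rpow_add Real.pi_pos]
    simp
    ring
  · refine Integrable.const_mul (Integrable.of_integral_ne_zero ?_) _
    rw [hint, Real.Gamma_one_half_eq]
    positivity
  · refine (ae_restrict_mem measurableSet_Ioi).mono fun t ht => ?_
    have : (0 : ℝ) < t := ht
    positivity

theorem integrable_hyp_pow (m : ℕ) :
    Integrable fun y : Fin m → ℝ => (hyp y)⁻¹ ^ (m + 1) := by
  refine ⟨((measurable_hyp.inv).pow_const _).aestronglyMeasurable, ?_⟩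
  rw [hasFiniteIntegral_iff_ofReal (Filter.Eventually.of_forall fun y => by
    have := hyp_pos y
    positivity), lintegral_hyp_pow]
  exact ENNReal.ofReal_lt_top

theorem integral_hyp_pow (m : ℕ) :
    ∫ y : Fin m → ℝ, (hyp y)⁻¹ ^ (m + 1) =
      Real.pi ^ (((m : ℝ) + 1) / 2) / Real.Gamma (((m : ℝ) + 1) / 2) := by
  have := Real.Gamma_pos_of_pos (s := ((m : ℝ) + 1) / 2) (by positivity)
  rw [integral_eq_lintegral_of_nonneg_ae, lintegral_hyp_pow, ENNReal.toReal_ofReal (by positivity)]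
  · exact Filter.Eventually.of_forall fun y => by
      have := hyp_pos y
      positivity
  · exact (integrable_hyp_pow m).1

end ProjectiveVolume

section Integrability

theorem integrable_one_add_abs_pow (k : ℕ) :
    Integrable (fun x : ℝ => (1 + |x|) ^ k) (gaussianReal 0 1) := by
  have h0 : MemLp (fun x : ℝ => ‖id x‖) (k : ENNReal) (gaussianReal 0 1) :=
    (memLp_id_gaussianReal' (k : ENNReal) (ENNReal.natCast_ne_top k)).norm
  have hc : MemLp (fun _ : ℝ => (1 : ℝ)) (k : ENNReal) (gaussianReal 0 1) := memLp_const 1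
  have h2 := (hc.add h0).integrable_norm_pow'
  refine h2.congr (Filter.Eventually.of_forall fun x => ?_)
  simp only [Pi.add_apply, id_eq, Real.norm_eq_abs]
  rw [abs_of_nonneg (by positivity)]

theorem measurable_det_blockMatrix {p : ℕ} (n : Fin p → ℕ) :
    Measurable fun w : W1 n => (blockMatrix w).det := by
  simp only [Matrix.det_apply]
  refine Finset.measurable_fun_sum _ fun σ _ => Measurable.const_smul ?_ _
  refine Finset.measurable_fun_prod _ fun a _ => ?_
  simp only [blockMatrix, Matrix.of_apply]
  split_ifs <;> fun_prop

/-- The determinant is bounded by a power of a bound of the entries, and the product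
`(1 + |w₀|) ∏ (1 + |w_z|)` is such a bound, all of whose powers are integrable. -/
theorem integrable_abs_det_blockMatrix {p : ℕ} (n : Fin p → ℕ) :
    Integrable (fun w : W1 n => |(blockMatrix w).det|) (gaussianW1 n) := by
  set k := Fintype.card (BlockIdx n) with hk
  set B : W1 n → ℝ := fun w => (1 + |w.1|) * ∏ z, (1 + |w.2 z|) with hB
  have hBint : Integrable (fun w => B w ^ k) (gaussianW1 n) := by
    simp only [hB, mul_pow, ← Finset.prod_pow]
    exact (integrable_one_add_abs_pow k).mul_prod
      (Integrable.fintype_prod fun _ => integrable_one_add_abs_pow k)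
  have hone : ∀ (w : W1 n) z, 1 ≤ 1 + |w.2 z| := fun w z => by linarith [abs_nonneg (w.2 z)]
  have hB1 : ∀ w, |w.1| ≤ B w := fun w => by
    have h1 : 1 ≤ ∏ z, (1 + |w.2 z|) := Finset.one_le_prod fun z _ => hone w z
    have h2 := abs_nonneg w.1
    simp only [hB]
    nlinarith
  have hB2 : ∀ w z, |w.2 z| ≤ B w := fun w z => by
    have h1 : 1 + |w.2 z| ≤ ∏ z, (1 + |w.2 z|) := by
      rw [← Finset.mul_prod_erase _ _ (Finset.mem_univ z)]
      exact le_mul_of_one_le_right (by positivity) (Finset.one_le_prod fun z _ => hone w z)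
    have h2 := abs_nonneg w.1
    have h3 := abs_nonneg (w.2 z)
    simp only [hB]
    nlinarith
  have hentry : ∀ w a b, |blockMatrix w a b| ≤ B w := by
    intro w a b
    simp only [blockMatrix, Matrix.of_apply]
    split_ifs
    · exact hB2 w _
    · exact hB2 w _
    · exact hB1 w
    · rw [abs_zero]
      exact (abs_nonneg _).trans (hB1 w)
  refine (hBint.const_mul (Nat.factorial k : ℝ)).mono'
    (measurable_det_blockMatrix n).abs.aestronglyMeasurable (Filter.Eventually.of_forall fun w => ?_)
  rw [Real.norm_eq_abs, abs_abs]
  have h := Matrix.det_le (abv := (AbsoluteValue.abs : AbsoluteValue ℝ ℝ)) (hentry w)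
  rwa [nsmul_eq_mul] at h

end Integrability

end RankOneApprox

/-! ### Integration of the Jacobian -/

namespace RankOneApprox

open MeasureTheory ProbabilityTheory

section Marginal

/-- Choosing one distinguished coordinate of a standard Gaussian vector, and the negatives of some of
the others; the signs turn `w₀ I - C` into a matrix with the distribution of `C(w₁)`. -/
theorem measurePreserving_gaussian_select {τ κ : Type*} [Fintype τ] [Fintype κ] {t₀ : τ} {g : κ → τ}
    (hg : Function.Injective g) (ht₀ : ∀ k, g k ≠ t₀) :
    MeasurePreserving (fun w : τ → ℝ => (w t₀, fun k => -w (g k)))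
      (Measure.pi fun _ => gaussianReal 0 1)
      ((gaussianReal 0 1).prod (Measure.pi fun _ => gaussianReal 0 1)) := by
  classical
  have hneg : MeasurePreserving (fun x : ℝ => -x) (gaussianReal 0 1) (gaussianReal 0 1) :=
    ⟨by fun_prop, by rw [gaussianReal_map_neg, neg_zero]⟩
  let _ : Fintype {t // t = t₀} := Subtype.fintype _
  have h1 := measurePreserving_piEquivPiSubtypeProd (fun _ : τ => gaussianReal 0 1) (· = t₀)
  have h2 := measurePreserving_eval (fun _ : {t // t = t₀} => gaussianReal 0 1) ⟨t₀, rfl⟩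
  have h3 := measurePreserving_select (g := fun k => (⟨g k, ht₀ k⟩ : {t // ¬t = t₀})) hneg
    fun a b hab => hg (Subtype.ext_iff.1 hab)
  exact (h2.prod h3).comp h1

variable {p : ℕ} {m : Fin p → ℕ}

theorem doubleIdx_of_ne (z : OffDiagIdx (fun i => m i + 1)) {k : Fin p} (h1 : k ≠ z.1.1.1)
    (h2 : k ≠ z.1.2.1) : doubleIdx z k = 0 := by
  rw [doubleIdx, Function.update_of_ne h2, unitIdx_of_ne _ h1]

theorem doubleIdx_injective : Function.Injective (doubleIdx (m := m)) := by
  have hsupp : ∀ (z z' : OffDiagIdx (fun i => m i + 1)), doubleIdx z = doubleIdx z' →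
      (z.1.1.1 = z'.1.1.1 ∨ z.1.1.1 = z'.1.2.1) ∧ (z.1.2.1 = z'.1.1.1 ∨ z.1.2.1 = z'.1.2.1) := by
    intro z z' h
    constructor
    · by_contra! hne
      have := congrFun h z.1.1.1
      rw [doubleIdx_fst, doubleIdx_of_ne z' hne.1 hne.2] at this
      exact Fin.succ_ne_zero _ this
    · by_contra! hne
      have := congrFun h z.1.2.1
      rw [doubleIdx_snd, doubleIdx_of_ne z' hne.1 hne.2] at this
      exact Fin.succ_ne_zero _ this
  intro z z' h
  have h1 := hsupp z z' h
  have h2 := hsupp z' z h.symm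
  have e1 : z.1.1.1 = z'.1.1.1 := by
    rcases h1.1 with h | h
    · exact h
    · have := z.2
      have := z'.2
      rcases h1.2 with h' | h' <;> omega
  have e2 : z.1.2.1 = z'.1.2.1 := by
    rcases h1.2 with h | h
    · have := z.2
      have := z'.2
      rcases h1.1 with h' | h' <;> omega
    · exact h
  have f1 := doubleIdx_fst z
  have f2 := doubleIdx_snd z
  have f1' := doubleIdx_fst z'
  have f2' := doubleIdx_snd z'
  rw [h] at f1 f2
  obtain ⟨⟨⟨i, a⟩, ⟨j, b⟩⟩, hz⟩ := z
  obtain ⟨⟨⟨i', a'⟩, ⟨j', b'⟩⟩, hz'⟩ := z'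
  obtain rfl : i = i' := e1
  obtain rfl : j = j' := e2
  obtain rfl : a = a' := Fin.succ_injective (m i) (f1.symm.trans f1')
  obtain rfl : b = b' := Fin.succ_injective (m j) (f2.symm.trans f2')
  rfl

/-- The coordinates `normalCoord q` as a function of the coordinates of `q` which are not at the
unit multi-indices. -/
def normalCoordRestrict (w : {α // α ∉ Set.range (unitIdx (m := m))} → ℝ) :
    W1 (fun i => m i + 1) :=
  (w ⟨0, zero_notMem_range_unitIdx⟩,
    fun z => -w ⟨doubleIdx z, doubleIdx_notMem_range_unitIdx z⟩)

theorem measurePreserving_normalCoordRestrict [Fintype {α // α ∉ Set.range (unitIdx (m := m))}] :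
    MeasurePreserving (normalCoordRestrict (m := m)) (Measure.pi fun _ => gaussianReal 0 1)
      (gaussianW1 fun i => m i + 1) := by
  refine measurePreserving_gaussian_select
    (t₀ := (⟨0, zero_notMem_range_unitIdx⟩ : {α // α ∉ Set.range (unitIdx (m := m))}))
    (g := fun z => (⟨doubleIdx z, doubleIdx_notMem_range_unitIdx z⟩ :
      {α // α ∉ Set.range (unitIdx (m := m))}))
    (fun a b hab => doubleIdx_injective (Subtype.ext_iff.1 hab)) fun z hz => ?_
  have h : doubleIdx z = 0 := Subtype.ext_iff.1 hz
  have h1 := congrFun h z.1.1.1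
  rw [doubleIdx_fst] at h1
  exact Fin.succ_ne_zero _ h1

end Marginal

section Integration

variable {p : ℕ} {m : Fin p → ℕ}

theorem sum_core_sq [Fintype {α // α ∉ Set.range (unitIdx (m := m))}]
    (q : ((i : Fin p) → Fin (m i + 1)) → ℝ) :
    ∑ α, core q α ^ 2 = ∑ α : {α // α ∉ Set.range (unitIdx (m := m))}, q α ^ 2 := by
  classical
  rw [← Finset.sum_subtype (Finset.univ.filter (· ∉ Set.range (unitIdx (m := m)))) (by simp)
    fun α => q α ^ 2, Finset.sum_filter]
  refine Finset.sum_congr rfl fun α _ => ?_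
  by_cases hα : α ∈ Set.range unitIdx
  · rw [core_of_mem hα, if_neg (not_not.2 hα), zero_pow two_ne_zero]
  · rw [core_of_notMem hα, if_pos hα]

theorem lintegral_prod_hyp_pow [Fintype {α // α ∈ Set.range (unitIdx (m := m))}] :
    ∫⁻ u : {α // α ∈ Set.range (unitIdx (m := m))} → ℝ,
      ENNReal.ofReal (∏ i, (hyp fun a => u ⟨unitIdx ⟨i, a⟩, ⟨i, a⟩, rfl⟩)⁻¹ ^ (m i + 1)) =
    ENNReal.ofReal (∏ i, (Real.pi ^ (((m i : ℝ) + 1) / 2) / Real.Gamma (((m i : ℝ) + 1) / 2))) := by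
  let e : ((i : Fin p) × Fin (m i)) ≃ {α // α ∈ Set.range (unitIdx (m := m))} :=
    Equiv.ofInjective _ unitIdx_injective
  have hmeas : Measurable fun u : {α // α ∈ Set.range (unitIdx (m := m))} → ℝ =>
      ENNReal.ofReal (∏ i, (hyp fun a => u ⟨unitIdx ⟨i, a⟩, ⟨i, a⟩, rfl⟩)⁻¹ ^ (m i + 1)) := by
    refine ENNReal.measurable_ofReal.comp (Finset.measurable_fun_prod _ fun i _ => ?_)
    exact ((measurable_hyp.comp (by fun_prop)).inv).pow_const _
  rw [← (measurePreserving_sigma_uncurry e).lintegral_comp hmeas]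
  have hsimp : ∀ (y : (i : Fin p) → Fin (m i) → ℝ) i a,
      y (e.symm ⟨unitIdx ⟨i, a⟩, ⟨i, a⟩, rfl⟩).1 (e.symm ⟨unitIdx ⟨i, a⟩, ⟨i, a⟩, rfl⟩).2 = y i a :=
    fun y i a => congrArg (fun s : (i : Fin p) × Fin (m i) => y s.1 s.2)
      (e.symm_apply_apply ⟨i, a⟩)
  simp only [hsimp]
  rw [volume_pi, lintegral_ofReal_prod (fun i => integrable_hyp_pow (m i)) fun i y => by
    have := hyp_pos y
    positivity]
  simp only [integral_hyp_pow]

theorem prod_gaussianPDFReal {τ : Type*} [Fintype τ] (w : τ → ℝ) :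
    Real.exp (-(∑ t, w t ^ 2) / 2) =
      (2 * Real.pi) ^ ((Fintype.card τ : ℝ) / 2) * ∏ t, gaussianPDFReal 0 1 (w t) := by
  have h2π : (0 : ℝ) < 2 * Real.pi := by positivity
  simp only [gaussianPDFReal, NNReal.coe_one, mul_one, sub_zero, Finset.prod_mul_distrib,
    Finset.prod_const, Finset.card_univ, ← Real.exp_sum]
  rw [Real.sqrt_eq_rpow, ← Real.rpow_neg h2π.le, ← Real.rpow_natCast, ← Real.rpow_mul h2π.le,
    ← mul_assoc, ← Real.rpow_add h2π, show (Fintype.card τ : ℝ) / 2 +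
      -(1 / 2) * (Fintype.card τ : ℝ) = 0 by ring, Real.rpow_zero, one_mul, ← Finset.sum_div,
    Finset.sum_neg_distrib]

theorem lintegral_normal [Fintype {α // α ∉ Set.range (unitIdx (m := m))}] :
    ∫⁻ w : {α // α ∉ Set.range (unitIdx (m := m))} → ℝ,
      ENNReal.ofReal |(blockMatrix (normalCoordRestrict w)).det| *
        ENNReal.ofReal (Real.exp (-(∑ α, w α ^ 2) / 2)) =
    ENNReal.ofReal ((2 * Real.pi) ^
        ((Fintype.card {α // α ∉ Set.range (unitIdx (m := m))} : ℝ) / 2) *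
      ∫ w, |(blockMatrix w).det| ∂gaussianW1 fun i => m i + 1) := by
  have hdet : Measurable fun w : W1 (fun i => m i + 1) =>
      ENNReal.ofReal |(blockMatrix w).det| :=
    ENNReal.measurable_ofReal.comp (measurable_det_blockMatrix _).abs
  have hmp := measurePreserving_normalCoordRestrict (m := m)
  have hpdf : Measurable fun w : {α // α ∉ Set.range (unitIdx (m := m))} → ℝ =>
      ENNReal.ofReal (∏ α, gaussianPDFReal 0 1 (w α)) := by
    refine ENNReal.measurable_ofReal.comp (Finset.measurable_fun_prod _ fun α _ => ?_)
    exact (measurable_gaussianPDFReal 0 1).comp (measurable_pi_apply α)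
  rw [ENNReal.ofReal_mul (by positivity), ofReal_integral_eq_lintegral_ofReal
    (integrable_abs_det_blockMatrix _) (Filter.Eventually.of_forall fun _ => abs_nonneg _),
    ← hmp.lintegral_comp hdet, pi_gaussianReal_eq_withDensity]
  refine Eq.trans ?_ (congrArg (_ * ·)
    (lintegral_withDensity_eq_lintegral_mul _ hpdf (hdet.comp hmp.measurable)).symm)
  rw [← lintegral_const_mul _ (hpdf.mul (hdet.comp hmp.measurable))]
  refine lintegral_congr fun w => ?_
  rw [prod_gaussianPDFReal, ENNReal.ofReal_mul (by positivity)]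
  simp only [Pi.mul_apply, Function.comp_apply]
  ring

theorem card_notMem_range_unitIdx [Fintype {α // α ∉ Set.range (unitIdx (m := m))}] :
    Fintype.card {α // α ∉ Set.range (unitIdx (m := m))} + ∑ i, m i = ∏ i, (m i + 1) := by
  classical
  have h1 : Fintype.card {α // α ∈ Set.range (unitIdx (m := m))} = ∑ i, m i := by
    rw [← Fintype.card_congr (Equiv.ofInjective _ (unitIdx_injective (m := m)))]
    simp
  have h2 := Fintype.card_congr (Equiv.sumCompl (· ∈ Set.range (unitIdx (m := m))))
  rw [Fintype.card_sum, h1, Fintype.card_pi] at h2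
  simp only [Fintype.card_fin] at h2
  rw [← h2, add_comm]

/-- The density of the standard Gaussian distribution on a space of dimension `N`. The dimension is
a separate argument since it appears as a product of the `nᵢ` and not as the cardinality of `I`. -/
noncomputable def gaussianDensity {I : Type*} [Fintype I] (N : ℕ) (v : I → ℝ) : ℝ :=
  1 / (2 * Real.pi) ^ ((N : ℝ) / 2) * Real.exp (-(∑ α, v α ^ 2) / 2)

/-- The Gaussian density at `param q` only depends on the coordinates on the normal space, and the
Jacobian is the product of a function of these and of one of the chart coordinates. -/
theorem lintegral_jacobian_mul_density :
    ∫⁻ q : ((i : Fin p) → Fin (m i + 1)) → ℝ, ENNReal.ofReal |(fderiv ℝ param q).det| *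
        ENNReal.ofReal (gaussianDensity (∏ i, (m i + 1)) (param q)) =
      ENNReal.ofReal ((2 * Real.pi) ^ (-((∑ i, m i : ℕ) : ℝ) / 2) *
        (∏ i, (Real.pi ^ (((m i : ℝ) + 1) / 2) / Real.Gamma (((m i : ℝ) + 1) / 2))) *
          ∫ w, |(blockMatrix w).det| ∂gaussianW1 fun i => m i + 1) := by
  classical
  let _ : Fintype {α // α ∈ Set.range (unitIdx (m := m))} := Subtype.fintype _
  let _ : Fintype {α // α ∉ Set.range (unitIdx (m := m))} := Subtype.fintype _
  set c : ℝ := 1 / (2 * Real.pi) ^ (((∏ i, (m i + 1) : ℕ) : ℝ) / 2) with hc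
  have hc0 : 0 ≤ c := by positivity
  set f₁ : ({α // α ∈ Set.range (unitIdx (m := m))} → ℝ) → ENNReal := fun u =>
    ENNReal.ofReal (∏ i, (hyp fun a => u ⟨unitIdx ⟨i, a⟩, ⟨i, a⟩, rfl⟩)⁻¹ ^ (m i + 1)) with hf₁
  set f₂ : ({α // α ∉ Set.range (unitIdx (m := m))} → ℝ) → ENNReal := fun w =>
    ENNReal.ofReal |(blockMatrix (normalCoordRestrict w)).det| *
      ENNReal.ofReal (Real.exp (-(∑ α, w α ^ 2) / 2)) with hf₂
  have hf₁m : Measurable f₁ := by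
    refine ENNReal.measurable_ofReal.comp (Finset.measurable_fun_prod _ fun i _ => ?_)
    exact ((measurable_hyp.comp (by fun_prop)).inv).pow_const _
  have hf₂m : Measurable f₂ := by
    refine Measurable.mul (ENNReal.measurable_ofReal.comp ((measurable_det_blockMatrix _).comp
      measurePreserving_normalCoordRestrict.measurable).abs) (by fun_prop)
  have hsplit : ∀ q : ((i : Fin p) → Fin (m i + 1)) → ℝ,
      ENNReal.ofReal |(fderiv ℝ param q).det| *
        ENNReal.ofReal (gaussianDensity (∏ i, (m i + 1)) (param q)) =
      ENNReal.ofReal c * (f₁ (fun α => q α) * f₂ fun α => q α) := by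
    intro q
    have hpos : 0 ≤ ∏ i, (hyp (chart q i))⁻¹ ^ (m i + 1) :=
      Finset.prod_nonneg fun i _ => pow_nonneg (inv_nonneg.2 (hyp_pos _).le) _
    rw [abs_det_fderiv_param, gaussianDensity, sum_param_sq, sum_core_sq,
      ENNReal.ofReal_mul (abs_nonneg _), ENNReal.ofReal_mul hc0]
    simp only [hf₁, hf₂]
    rw [show normalCoordRestrict (fun α : {α // α ∉ Set.range (unitIdx (m := m))} => q α) =
      normalCoord q from rfl]
    change ENNReal.ofReal _ * ENNReal.ofReal (∏ i, (hyp (chart q i))⁻¹ ^ (m i + 1)) * _ =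
      ENNReal.ofReal c * (ENNReal.ofReal (∏ i, (hyp (chart q i))⁻¹ ^ (m i + 1)) * _)
    ring
  have hmp := volume_preserving_piEquivPiSubtypeProd
    (fun _ : (i : Fin p) → Fin (m i + 1) => ℝ) (· ∈ Set.range (unitIdx (m := m)))
  have hprod : ∫⁻ q : ((i : Fin p) → Fin (m i + 1)) → ℝ, f₁ (fun α => q α) * f₂ (fun α => q α) =
      (∫⁻ u, f₁ u) * ∫⁻ w, f₂ w := by
    rw [← lintegral_prod_mul hf₁m.aemeasurable hf₂m.aemeasurable]
    exact hmp.lintegral_comp (f := fun z => f₁ z.1 * f₂ z.2) ((hf₁m.comp measurable_fst).mul (hf₂m.comp measurable_snd))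
  simp only [hsplit]
  rw [lintegral_const_mul' _ _ ENNReal.ofReal_ne_top, hprod, hf₁, hf₂, lintegral_prod_hyp_pow,
    lintegral_normal]
  have hΓ : 0 ≤ ∏ i, (Real.pi ^ (((m i : ℝ) + 1) / 2) / Real.Gamma (((m i : ℝ) + 1) / 2)) :=
    Finset.prod_nonneg fun i _ => div_nonneg (by positivity)
      (Real.Gamma_pos_of_pos (by positivity)).le
  rw [← ENNReal.ofReal_mul hΓ, ← ENNReal.ofReal_mul hc0]
  congr 1
  have hcard := card_notMem_range_unitIdx (m := m)
  have hconst : c * (2 * Real.pi) ^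
      ((Fintype.card {α // α ∉ Set.range (unitIdx (m := m))} : ℝ) / 2) =
        (2 * Real.pi) ^ (-((∑ i, m i : ℕ) : ℝ) / 2) := by
    have h2π : (0 : ℝ) < 2 * Real.pi := by positivity
    rw [hc, one_div, ← Real.rpow_neg h2π.le, ← Real.rpow_add h2π, ← hcard]
    congr 1
    push_cast
    ring
  rw [← hconst]
  ring

theorem measurable_gaussianDensity {I : Type*} [Fintype I] (N : ℕ) :
    Measurable (gaussianDensity N : (I → ℝ) → ℝ) := by
  unfold gaussianDensity
  fun_prop

theorem aemeasurable_fiberCount_param_and_lintegral :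
    AEMeasurable (fiberCount (param (m := m)) {q | q 0 ≠ 0}) volume ∧
      ∫⁻ v, fiberCount (param (m := m)) {q | q 0 ≠ 0} v *
          ENNReal.ofReal (gaussianDensity (∏ i, (m i + 1)) v) =
        ENNReal.ofReal ((2 * Real.pi) ^ (-((∑ i, m i : ℕ) : ℝ) / 2) *
          (∏ i, (Real.pi ^ (((m i : ℝ) + 1) / 2) / Real.Gamma (((m i : ℝ) + 1) / 2))) *
            ∫ w, |(blockMatrix w).det| ∂gaussianW1 fun i => m i + 1) := by
  have hs : MeasurableSet {q : ((i : Fin p) → Fin (m i + 1)) → ℝ | q 0 ≠ 0} :=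
    (measurableSet_eq_fun (measurable_pi_apply 0) measurable_const).compl
  have hdet : Measurable fun q : ((i : Fin p) → Fin (m i + 1)) → ℝ => (fderiv ℝ param q).det :=
    (ContinuousLinearMap.continuous_det.comp
      (contDiff_param.continuous_fderiv one_ne_zero)).measurable
  have hzero : MeasurableSet {q : ((i : Fin p) → Fin (m i + 1)) → ℝ |
      q ∈ {q : ((i : Fin p) → Fin (m i + 1)) → ℝ | q 0 ≠ 0} ∧ (fderiv ℝ param q).det = 0} :=
    hs.inter (hdet (measurableSet_singleton 0))
  have hg : Measurable fun v : ((i : Fin p) → Fin (m i + 1)) → ℝ =>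
      ENNReal.ofReal (gaussianDensity (∏ i, (m i + 1)) v) :=
    ENNReal.measurable_ofReal.comp (measurable_gaussianDensity _)
  have hderiv : ∀ q ∈ {q : ((i : Fin p) → Fin (m i + 1)) → ℝ | q 0 ≠ 0},
      HasFDerivWithinAt param (fderiv ℝ param q) {q | q 0 ≠ 0} q := fun q _ =>
    (contDiff_param.differentiable one_ne_zero q).hasFDerivAt.hasFDerivWithinAt
  obtain ⟨h1, h2⟩ := area_formula volume hs hderiv hzero hg
  refine ⟨h1, h2.trans ?_⟩
  have hae : {q : ((i : Fin p) → Fin (m i + 1)) → ℝ | q 0 ≠ 0} =ᵐ[volume] Set.univ := by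
    refine Filter.eventuallyEq_univ.2 (compl_mem_ae_iff.2 ?_)
    exact Measure.pi_hyperplane _ 0 0
  rw [setLIntegral_congr hae, setLIntegral_univ, lintegral_jacobian_mul_density]

theorem rpow_const_eq (m : Fin p → ℕ) :
    (2 * Real.pi) ^ (-((∑ i, m i : ℕ) : ℝ) / 2) *
        ∏ i, (Real.pi ^ (((m i : ℝ) + 1) / 2) / Real.Gamma (((m i : ℝ) + 1) / 2)) =
      (2 * Real.pi) ^ ((p : ℝ) / 2) / (2 : ℝ) ^ (((∑ i, (m i + 1) : ℕ) : ℝ) / 2) *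
        (1 / ∏ i, Real.Gamma (((m i + 1 : ℕ) : ℝ) / 2)) := by
  have hπ := Real.pi_pos
  have hsum : ((∑ i, (m i + 1) : ℕ) : ℝ) = ((∑ i, m i : ℕ) : ℝ) + p := by
    rw [Finset.sum_add_distrib]
    simp
  have hprod : ∏ i, Real.pi ^ (((m i : ℝ) + 1) / 2) =
      Real.pi ^ ((((∑ i, m i : ℕ) : ℝ) + p) / 2) := by
    rw [← Real.rpow_sum_of_pos hπ, ← hsum]
    congr 1
    push_cast
    rw [Finset.sum_div]
  rw [Finset.prod_div_distrib, hprod, hsum, Real.mul_rpow two_pos.le hπ.le,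
    Real.mul_rpow two_pos.le hπ.le, add_div, Real.rpow_add hπ, Real.rpow_add two_pos,
    neg_div, Real.rpow_neg two_pos.le, Real.rpow_neg hπ.le]
  push_cast
  field_simp

end Integration

end RankOneApprox

theorem theorem1p1 (p : ℕ) (hp : 1 ≤ p) (n : Fin p → ℕ) (hn : ∀ i, 1 ≤ n i) :
    AEMeasurable (fun v : RankOneApprox.Tensor n => RankOneApprox.critCount v)
        (RankOneApprox.tensorGaussian n) ∧
      MeasureTheory.Integrable
        (fun w : RankOneApprox.W1 n => |(RankOneApprox.blockMatrix w).det|)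
        (RankOneApprox.gaussianW1 n) ∧
      ∫⁻ v : RankOneApprox.Tensor n, RankOneApprox.critCount v ∂(RankOneApprox.tensorGaussian n) =
        ENNReal.ofReal
          ((2 * Real.pi) ^ ((p : ℝ) / 2) / (2 : ℝ) ^ (((∑ i, n i : ℕ) : ℝ) / 2) *
            (1 / ∏ i, Real.Gamma ((n i : ℝ) / 2)) *
            ∫ w : RankOneApprox.W1 n, |(RankOneApprox.blockMatrix w).det|
              ∂(RankOneApprox.gaussianW1 n)) := by
  obtain ⟨m, rfl⟩ : ∃ m : Fin p → ℕ, n = fun i => m i + 1 :=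
    ⟨fun i => n i - 1, funext fun i => (Nat.sub_add_cancel (hn i)).symm⟩
  obtain ⟨hmeas, hint⟩ := RankOneApprox.aemeasurable_fiberCount_param_and_lintegral (m := m)
  have hae := RankOneApprox.critCount_ae_eq (m := m) hp
  have hmp := PiLp.volume_preserving_ofLp ((i : Fin p) → Fin (m i + 1))
  have haeT : (fun v : RankOneApprox.Tensor fun i => m i + 1 => RankOneApprox.critCount v)
      =ᵐ[MeasureTheory.volume] fun v =>
        RankOneApprox.fiberCount RankOneApprox.param {q | q 0 ≠ 0} v.ofLp :=
    hmp.quasiMeasurePreserving.ae hae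
  have hmeasT : AEMeasurable (fun v : RankOneApprox.Tensor fun i => m i + 1 =>
      RankOneApprox.critCount v) MeasureTheory.volume :=
    (hmeas.comp_quasiMeasurePreserving hmp.quasiMeasurePreserving).congr haeT.symm
  refine ⟨hmeasT.mono_ac (MeasureTheory.withDensity_absolutelyContinuous _ _),
    RankOneApprox.integrable_abs_det_blockMatrix _, ?_⟩
  have hdens : Measurable fun v : RankOneApprox.Tensor fun i => m i + 1 =>
      ENNReal.ofReal (RankOneApprox.gaussianDensity (∏ i, (m i + 1)) v.ofLp) :=
    ENNReal.measurable_ofReal.comp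
      ((RankOneApprox.measurable_gaussianDensity _).comp hmp.measurable)
  rw [← RankOneApprox.rpow_const_eq m, ← hint]
  calc ∫⁻ v, RankOneApprox.critCount v ∂(RankOneApprox.tensorGaussian fun i => m i + 1)
      = ∫⁻ v : RankOneApprox.Tensor fun i => m i + 1,
          ENNReal.ofReal (RankOneApprox.gaussianDensity (∏ i, (m i + 1)) v.ofLp) *
            RankOneApprox.critCount v :=
        MeasureTheory.lintegral_withDensity_eq_lintegral_mul₀ hdens.aemeasurable hmeasT
    _ = ∫⁻ v : RankOneApprox.Tensor fun i => m i + 1,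
          RankOneApprox.fiberCount RankOneApprox.param {q | q 0 ≠ 0} v.ofLp *
            ENNReal.ofReal (RankOneApprox.gaussianDensity (∏ i, (m i + 1)) v.ofLp) := by
        refine MeasureTheory.lintegral_congr_ae (haeT.mono fun v hv => ?_)
        simp only [hv, mul_comm]
    _ = _ := hmp.lintegral_comp_emb
        (MeasurableEquiv.toLp 2 _).symm.measurableEmbedding fun v =>
          RankOneApprox.fiberCount RankOneApprox.param {q | q 0 ≠ 0} v *
            ENNReal.ofReal (RankOneApprox.gaussianDensity (∏ i, (m i + 1)) v)
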